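/- Let $\mathcal T_n$ be an $n$-qubit unitary $2$-design, i.e. a (Borel) probability measure $\mu$ on the unitary group $U(2^n)$ with $\mathbb E_{U\sim\mu}\,U^{\dagger\otimes 2}AU^{\otimes 2}=\mathbb E_{U\sim\mathrm{Haar}}\,U^{\dagger\otimes 2}AU^{\otimes 2}$ for every operator $A$ on $(\mathbb C^{2^n})^{\otimes 2}$. Let $f(\mathbf a,\mathbf b)=2^n$ if $\mathbf a=\mathbf b$ and $f(\mathbf a,\mathbf b)=-1$ otherwise, for $\mathbf a,\mathbf b\in\mathbb Z_2^n$. For $n$-qubit states $\rho,\sigma$ and $m\ge 1$, one round of distributed inner product estimation draws $U\sim\mu$ and, given $U$, independent outcomes $\mathbf a_1,\dots,\mathbf a_m$ with law $\mathbf a\mapsto\langle\mathbf a|U\rho U^\dagger|\mathbf a\rangle$ and $\mathbf b_1,\dots,\mathbf b_m$ with law $\mathbf b\mapsto\langle\mathbf b|U\sigma U^\dagger|\mathbf b\rangle$; it outputs $\mathbb X_m=\frac1{m^2}\sum_{i,j=1}^m f(\mathbf a_i,\mathbf b_j)$, whose variance is denoted $\mathbb V_{\mathcal T_n}(\mathbb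 X_m)$. The estimator $\hat\omega$ of $\mathrm{tr}[\rho\sigma]$ is the mean of the outputs of $N$ independent rounds; it uses $Nm$ copies of each state. Define the average variances $$\mathbb V^a_{\mathcal T_n,1}=\mathbb E_\psi\,\mathbb V_{\mathcal T_n}(\mathbb X_m)\ \text{ with }\rho=\sigma=|\psi\rangle\langle\psi|,\qquad \mathbb V^a_{\mathcal T_n,2}=\mathbb E_{\psi,\phi}\,\mathbb V_{\mathcal T_n}(\mathbb X_m)\ \text{ with }\rho=|\psi\rangle\langle\psi|,\ \sigma=|\phi\rangle\langle\phi|,$$ where $\psi,\phi$ are independent Haar random pure states. There is a universal constant $C>0$ such that the following hold. (1) For all $n$, all $m\ge1$ and every unitary $2$-design $\mathcal T_n$, the two averages exist (the variances are integrable functions of the random states) and $$\mathbb V^a_{\mathcal T_n,1},\ \mathbb V^a_{\mathcal T_n,2}\ \le\ C\left(\frac{2^n}{m^2}+\frac1m+\frac1{2^n}\right).$$ (2) Consequently, the average sample complexity is $\mathcal O(\sqrt{2^n})$: for all $n$ and all $\varepsilon,\delta\in(0,1)$ there are integers $N,m\ge1$, depending only on $n,\varepsilon,\delta$, with $$Nm\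 \le\ C\max\left\{\frac1{\delta\varepsilon^2},\sqrt{\frac{2^n}{\delta\varepsilon^2}}\right\}\qquad\text{and}\qquad Nm\ \le\ \frac{C}{\delta\varepsilon^2}\sqrt{2^n},$$ such that for every unitary $2$-design $\mathcal T_n$ one has $N\ge \mathbb V^a_{\mathcal T_n,i}/(\delta\varepsilon^2)$ for $i=1,2$, and, in each of the two cases, the probability of $|\hat\omega-\mathrm{tr}[\rho\sigma]|\ge\varepsilon$, averaged over the Haar random input states, is at most $\delta$. -/

import Mathlib

open MeasureTheory ProbabilityTheory Matrix

noncomputable section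

namespace DIPE

/-- Bit strings of length `n`, the labels of the computational basis of `n` qubits. -/
abbrev Bits (n : ℕ) : Type := Fin n → ZMod 2

/-- Operators on the `n`-qubit space, as matrices in the computational basis. -/
abbrev Op (n : ℕ) : Type := Matrix (Bits n) (Bits n) ℂ

/-- The `n`-qubit unitary group. -/
abbrev UGroup (n : ℕ) : Type := Matrix.unitaryGroup (Bits n) ℂ

/-- The unitary group carries its Borel sigma-algebra. -/
instance instMeasurableSpaceUGroup (n : ℕ) : MeasurableSpace (UGroup n) := borel _

instance instBorelSpaceUGroup (n : ℕ) : BorelSpace (UGroup n) := ⟨rfl⟩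

instance instCompactSpaceUGroup (n : ℕ) : CompactSpace (UGroup n) := by
  refine (isCompact_iff_compactSpace (s := (Matrix.unitaryGroup (Bits n) ℂ : Set (Op n)))).mp ?_
  have hc : IsCompact
      (Set.univ.pi fun _ : Bits n => Set.univ.pi fun _ : Bits n => Metric.closedBall (0 : ℂ) 1) :=
    isCompact_univ_pi fun _ => isCompact_univ_pi fun _ => isCompact_closedBall _ _
  refine IsCompact.of_isClosed_subset hc ?_ ?_
  · have h : {A : Op n | star A * A = 1} ∩ {A : Op n | A * star A = 1}
        = (Matrix.unitaryGroup (Bits n) ℂ : Set (Op n)) := by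
      ext A
      exact Iff.rfl
    have h2 : IsClosed ({A : Op n | star A * A = 1} ∩ {A : Op n | A * star A = 1}) :=
      (isClosed_eq (by fun_prop) continuous_const).inter
        (isClosed_eq (by fun_prop) continuous_const)
    rw [h] at h2
    exact h2
  · intro A hA i _ j _
    simpa using entry_norm_bound_of_unitary hA i j

/-- The Haar probability measure on the `n`-qubit unitary group. -/
def haarUnitary (n : ℕ) : Measure (UGroup n) := Measure.haarMeasure ⊤

/-- The law of a Haar random pure state: `U|0…0⟩` with `U` a Haar random unitary. A state vector is
given by its amplitudes in the computational basis. -/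
def haarState (n : ℕ) : Measure (Bits n → ℂ) :=
  (haarUnitary n).map fun U : UGroup n => (U : Op n) *ᵥ Pi.single 0 1

/-- The rank-one operator `|ψ⟩⟨ψ|`. -/
def ketbra {n : ℕ} (ψ : Bits n → ℂ) : Op n := Matrix.vecMulVec ψ (star ψ)

/-- The `k`-th tensor power of an operator, a matrix indexed by `k`-tuples of basis labels. -/
def tensorPower {n : ℕ} (k : ℕ) (A : Op n) : Matrix (Fin k → Bits n) (Fin k → Bits n) ℂ :=
  Matrix.of fun x y => ∏ i, A (x i) (y i)

/-- The `k`-moment channel `A ↦ 𝔼_{U ∼ μ} (U†)^{⊗k} A U^{⊗k}` of an ensemble `μ`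
(the expectation of a matrix is taken entrywise). -/
def momentChannel {n : ℕ} (μ : Measure (UGroup n)) (k : ℕ)
    (A : Matrix (Fin k → Bits n) (Fin k → Bits n) ℂ) :
    Matrix (Fin k → Bits n) (Fin k → Bits n) ℂ :=
  Matrix.of fun x y =>
    ∫ U, (tensorPower k (U : Op n)ᴴ * A * tensorPower k (U : Op n)) x y ∂μ

/-- A unitary `k`-design: the `k`-moment channel agrees with that of the Haar measure. -/
def IsUnitaryDesign {n : ℕ} (μ : Measure (UGroup n)) (k : ℕ) : Prop :=
  ∀ A, momentChannel μ k A = momentChannel (haarUnitary n) k A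

/-- The classical function of a unitary 2-design: `2^n` on the diagonal and `-1` off it. -/
def classicalFun {n : ℕ} (a b : Bits n) : ℝ := if a = b then 2 ^ n else -1

/-- The Born probability `⟨a|U ρ U†|a⟩` of the outcome `a` when `ρ` is rotated by `U` and measured
in the computational basis. -/
def bornProb {n : ℕ} (U : UGroup n) (ρ : Op n) (a : Bits n) : ℝ :=
  (((U : Op n) * ρ * (U : Op n)ᴴ) a a).re

/-- The outcomes of one round with `m` shots on each of the two platforms. -/
abbrev Outcome (n m : ℕ) : Type := (Fin m → Bits n) × (Fin m → Bits n)

/-- The probability of an outcome of one round: `U ∼ μ` is shared by both platforms, and given `U`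
all the shots are independent. -/
def roundProb {n m : ℕ} (μ : Measure (UGroup n)) (ρ σ : Op n) (o : Outcome n m) : ℝ :=
  ∫ U, (∏ i, bornProb U ρ (o.1 i)) * ∏ j, bornProb U σ (o.2 j) ∂μ

/-- The law of the outcome of one round. -/
def roundLaw {n : ℕ} (μ : Measure (UGroup n)) (ρ σ : Op n) (m : ℕ) : Measure (Outcome n m) :=
  ∑ o : Outcome n m, ENNReal.ofReal (roundProb μ ρ σ o) • Measure.dirac o

/-- The one-round estimator `X_m = m⁻² ∑_{i,j} f(a_i, b_j)`. -/
def roundEstimator {n m : ℕ} (o : Outcome n m) : ℝ :=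
  1 / (m : ℝ) ^ 2 * ∑ i, ∑ j, classicalFun (o.1 i) (o.2 j)

/-- The variance of the one-round estimator on the inputs `ρ` and `σ`. -/
def estimatorVariance {n : ℕ} (μ : Measure (UGroup n)) (m : ℕ) (ρ σ : Op n) : ℝ :=
  Var[roundEstimator; roundLaw μ ρ σ m]

/-- The average variance in case 1: both platforms hold the same Haar random pure state. -/
def averageVarianceOne {n : ℕ} (μ : Measure (UGroup n)) (m : ℕ) : ℝ :=
  ∫ ψ, estimatorVariance μ m (ketbra ψ) (ketbra ψ) ∂haarState n

/-- The average variance in case 2: the platforms hold independent Haar random pure states. -/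
def averageVarianceTwo {n : ℕ} (μ : Measure (UGroup n)) (m : ℕ) : ℝ :=
  ∫ p, estimatorVariance μ m (ketbra p.1) (ketbra p.2) ∂(haarState n).prod (haarState n)

/-- The mean estimator over `N` rounds. -/
def meanEstimator {n m N : ℕ} (ω : Fin N → Outcome n m) : ℝ :=
  1 / (N : ℝ) * ∑ t, roundEstimator (ω t)

/-- The probability that the mean estimator over `N` independent rounds with `m` shots each misses
`tr (ρ σ)` by at least `ε`. -/
def failureProb {n : ℕ} (μ : Measure (UGroup n)) (N m : ℕ) (ε : ℝ) (ρ σ : Op n) : ENNReal :=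
  (Measure.pi fun _ : Fin N => roundLaw μ ρ σ m)
    {ω | ε ≤ |meanEstimator ω - (ρ * σ).trace.re|}

/-- The failure probability averaged over the input states of case 1. -/
def averageFailureOne {n : ℕ} (μ : Measure (UGroup n)) (N m : ℕ) (ε : ℝ) : ENNReal :=
  ∫⁻ ψ, failureProb μ N m ε (ketbra ψ) (ketbra ψ) ∂haarState n

/-- The failure probability averaged over the input states of case 2. -/
def averageFailureTwo {n : ℕ} (μ : Measure (UGroup n)) (N m : ℕ) (ε : ℝ) : ENNReal :=
  ∫⁻ p, failureProb μ N m ε (ketbra p.1) (ketbra p.2) ∂(haarState n).prod (haarState n)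

end DIPE

end

/-!
Write `d = 2 ^ n`, and let `p a = |(U ψ) a|²` and `q b = |(U φ) b|²` be the outcome probabilities
given the rotation `U`. Given `U`, the estimator has mean `g = (d + 1) ∑ a, p a * q a - 1`. A
2-design reproduces the second moment tensor `(δᵢⱼ δₖₗ + δᵢₗ δⱼₖ) / (d (d + 1))` of a row of a Haar unitary
(`IsUnitaryDesign.integral_row_tensor`), so the mean of `g` over `U` is `|⟨ψ|φ⟩|²`: the estimator is
unbiased for every pair of pure states (`IsUnitaryDesign.integral_roundEstimator`).

The variance involves moments of `U` up to order four, which a 2-design does not control. But the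
average over Haar random inputs does: the law of `(U ψ, U φ)` does not depend on `U`, so by Fubini
the rotation disappears from the average (`integral_integral_mulVec`,
`integral_integral_mulVec_prod`). What remains is the second moment of the estimator for independent samples from `p` and `q`. Sorting
the pairs of its summands by shared shots (`sum_prod_mul_double_sum_sq`) bounds it by
`(1 + d² S) / m² + (2 + (d + 1)² (K + L)) / m + g²` with `S = ∑ p q`, `K = ∑ q p²`, `L = ∑ p q²`
(`sampleMean_roundEstimator_sq_le`), and the averages of these are explicit moments
of a Haar random state.

The moments are derived from unitary invariance alone. Differentiating the mean of
`A ^ p * B ^ q * Re (v a * conj (v b))`, with `A = |v a|²` and `B = |v b|²`, along a rotation of the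
plane of two coordinates gives `(p + 1) E[A ^ p B ^ (q + 1)] = (q + 1) E[A ^ (p + 1) B ^ q]`
(`IsInvariantLaw.moment_recurrence`), and `∑ a, |v a|² = 1` fixes the constants
(`IsInvariantLaw.moment_succ`).

The sample complexity follows from Chebyshev's inequality and a choice of the numbers of rounds and
shots (`exists_rounds_and_shots`).
-/

noncomputable section

namespace DIPE

/-! ### Unitarily invariant laws of unit vectors -/

section InvariantLaw

variable {ι : Type*} [Fintype ι]

lemma normSq_le_one_of_sum_eq_one {v : ι → ℂ} (hv : ∑ a, Complex.normSq (v a) = 1) (a : ι) :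
    Complex.normSq (v a) ≤ 1 := by
  rw [← hv]
  exact Finset.single_le_sum (fun b _ => Complex.normSq_nonneg (v b)) (Finset.mem_univ a)

lemma isCompact_unitVectors : IsCompact {v : ι → ℂ | ∑ a, Complex.normSq (v a) = 1} := by
  refine IsCompact.of_isClosed_subset
    (isCompact_univ_pi fun _ : ι => isCompact_closedBall (0 : ℂ) 1) ?_ ?_
  · exact isClosed_eq (by fun_prop) continuous_const
  · intro v hv i _
    have h := normSq_le_one_of_sum_eq_one hv i
    rw [Complex.normSq_eq_norm_sq] at h
    rw [mem_closedBall_zero_iff]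
    nlinarith [norm_nonneg (v i)]

variable [DecidableEq ι]

/-- A probability law of unit vectors of `ℂ^ι` that is invariant under every unitary. -/
structure IsInvariantLaw (ν : Measure (ι → ℂ)) : Prop where
  prob : IsProbabilityMeasure ν
  invariant : ∀ V ∈ Matrix.unitaryGroup ι ℂ, ν.map (fun v => V *ᵥ v) = ν
  unit_norm : ∀ᵐ v ∂ν, ∑ a, Complex.normSq (v a) = 1

namespace IsInvariantLaw

variable {ν : Measure (ι → ℂ)}

lemma integrable (hν : IsInvariantLaw ν) {E : Type*} [NormedAddCommGroup E]
    [SecondCountableTopology E] {f : (ι → ℂ) → E} (hf : Continuous f) : Integrable f ν := by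
  have := hν.prob
  obtain ⟨C, hC⟩ := isCompact_unitVectors.exists_bound_of_continuousOn hf.continuousOn
  borelize E
  refine Integrable.of_bound hf.aestronglyMeasurable C ?_
  filter_upwards [hν.unit_norm] with v hv using hC v hv

lemma integral_mulVec (hν : IsInvariantLaw ν) {E : Type*} [NormedAddCommGroup E]
    [NormedSpace ℝ E] [SecondCountableTopology E] {f : (ι → ℂ) → E} (hf : Continuous f)
    {V : Matrix ι ι ℂ} (hV : V ∈ Matrix.unitaryGroup ι ℂ) :
    ∫ v, f (V *ᵥ v) ∂ν = ∫ v, f v ∂ν := by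
  borelize E
  conv_rhs => rw [← hν.invariant V hV]
  rw [integral_map (by fun_prop) hf.aestronglyMeasurable]

end IsInvariantLaw

/-- The diagonal unitary multiplying the coordinate `s` by `i`. -/
def phaseMatrix (s : ι) : Matrix ι ι ℂ := Matrix.diagonal fun a => if a = s then Complex.I else 1

lemma phaseMatrix_mem (s : ι) : phaseMatrix s ∈ Matrix.unitaryGroup ι ℂ := by
  rw [Matrix.mem_unitaryGroup_iff, phaseMatrix, Matrix.star_eq_conjTranspose,
    Matrix.diagonal_conjTranspose, Matrix.diagonal_mul_diagonal, ← Matrix.diagonal_one]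
  congr 1
  funext a
  by_cases h : a = s <;> simp [h]

lemma phaseMatrix_mulVec (s : ι) (v : ι → ℂ) (a : ι) :
    (phaseMatrix s *ᵥ v) a = (if a = s then Complex.I else 1) * v a := by
  rw [phaseMatrix, Matrix.mulVec_diagonal]

/-- The rotation by the angle `t` in the plane of the coordinates `a` and `b`. -/
def planeRotation (a b : ι) (t : ℝ) : Matrix ι ι ℂ :=
  Matrix.of fun i j =>
    if i = a then (if j = a then (Real.cos t : ℂ) else 0) + (if j = b then (Real.sin t : ℂ) else 0)
    else if i = b then
      (if j = a then (-Real.sin t : ℂ) else 0) + (if j = b then (Real.cos t : ℂ) else 0)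
    else if i = j then 1 else 0

lemma planeRotation_mulVec (a b : ι) (t : ℝ) (v : ι → ℂ) (i : ι) :
    (planeRotation a b t *ᵥ v) i =
      if i = a then Real.cos t * v a + Real.sin t * v b
      else if i = b then -Real.sin t * v a + Real.cos t * v b else v i := by
  simp only [planeRotation, Matrix.mulVec, dotProduct, Matrix.of_apply]
  split_ifs <;> simp [add_mul, Finset.sum_add_distrib]

omit [Fintype ι] in
lemma star_planeRotation {a b : ι} (hab : a ≠ b) (t : ℝ) :
    star (planeRotation a b t) = planeRotation a b (-t) := by
  ext i j
  simp only [planeRotation, Matrix.star_apply, Matrix.of_apply, Real.cos_neg, Real.sin_neg]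
  by_cases hia : i = a <;> by_cases hib : i = b <;> by_cases hja : j = a <;>
    by_cases hjb : j = b <;> by_cases hij : i = j <;> 
    simp_all [eq_comm, -Complex.ofReal_cos, -Complex.ofReal_sin]

lemma planeRotation_mem {a b : ι} (hab : a ≠ b) (t : ℝ) :
    planeRotation a b t ∈ Matrix.unitaryGroup ι ℂ := by
  rw [Matrix.mem_unitaryGroup_iff', star_planeRotation hab]
  refine Matrix.ext_of_mulVec_single fun j => ?_
  rw [← Matrix.mulVec_mulVec, Matrix.one_mulVec]
  funext i
  have h : (Real.cos t : ℂ) * Real.cos t + Real.sin t * Real.sin t = 1 := by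
    have := Real.cos_sq_add_sin_sq t
    exact_mod_cast (by linarith : Real.cos t * Real.cos t + Real.sin t * Real.sin t = 1)
  generalize (Pi.single j 1 : ι → ℂ) = w
  simp only [planeRotation_mulVec, if_neg hab.symm, if_true, Real.cos_neg, Real.sin_neg]
  split_ifs with h1 h2
  · subst h1; push_cast; push_cast at h; linear_combination w i * h
  · subst h2; push_cast; push_cast at h; linear_combination w i * h
  · rfl

end InvariantLaw

/-! ### Moments of a unitarily invariant law -/

section Moments

variable {ι : Type*}

/-- The real part of `v a * conj (v b)`. -/
def crossRe (v : ι → ℂ) (a b : ι) : ℝ := (v a).re * (v b).re + (v a).im * (v b).im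

@[fun_prop]
lemma continuous_normSq_coord (a : ι) : Continuous fun v : ι → ℂ => Complex.normSq (v a) :=
  Complex.continuous_normSq.comp (continuous_apply a)

@[fun_prop]
lemma continuous_crossRe (a b : ι) : Continuous fun v : ι → ℂ => crossRe v a b := by
  unfold crossRe
  have ha : Continuous fun v : ι → ℂ => v a := continuous_apply a
  have hb : Continuous fun v : ι → ℂ => v b := continuous_apply b
  exact ((Complex.continuous_re.comp ha).mul (Complex.continuous_re.comp hb)).add
    ((Complex.continuous_im.comp ha).mul (Complex.continuous_im.comp hb))

/-- The value of `|v a|²` after a rotation by `t` of the `(a, b)` plane, in terms of the values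
`A`, `B`, `R` of `|v a|²`, `|v b|²`, `Re (v a * conj (v b))` before it. -/
def rotatedFst (t A B R : ℝ) : ℝ :=
  Real.cos t ^ 2 * A + Real.sin t ^ 2 * B + 2 * Real.cos t * Real.sin t * R

/-- The value of `|v b|²` after a rotation by `t` of the `(a, b)` plane. -/
def rotatedSnd (t A B R : ℝ) : ℝ :=
  Real.sin t ^ 2 * A + Real.cos t ^ 2 * B - 2 * Real.cos t * Real.sin t * R

/-- The value of `Re (v a * conj (v b))` after a rotation by `t` of the `(a, b)` plane. -/
def rotatedCross (t A B R : ℝ) : ℝ :=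
  (Real.cos t ^ 2 - Real.sin t ^ 2) * R + Real.cos t * Real.sin t * (B - A)

lemma rotatedFst_zero (A B R : ℝ) : rotatedFst 0 A B R = A := by simp [rotatedFst]

lemma rotatedSnd_zero (A B R : ℝ) : rotatedSnd 0 A B R = B := by simp [rotatedSnd]

lemma rotatedCross_zero (A B R : ℝ) : rotatedCross 0 A B R = R := by simp [rotatedCross]

lemma hasDerivAt_rotatedFst (t A B R : ℝ) :
    HasDerivAt (fun x => rotatedFst x A B R) (2 * rotatedCross t A B R) t := by
  have h := ((((Real.hasDerivAt_cos t).pow 2).mul_const A).add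
    (((Real.hasDerivAt_sin t).pow 2).mul_const B)).add
    ((((Real.hasDerivAt_cos t).const_mul 2).mul (Real.hasDerivAt_sin t)).mul_const R)
  refine HasDerivAt.congr_deriv h ?_
  simp only [rotatedCross]; push_cast; ring

lemma hasDerivAt_rotatedSnd (t A B R : ℝ) :
    HasDerivAt (fun x => rotatedSnd x A B R) (-2 * rotatedCross t A B R) t := by
  have h := ((((Real.hasDerivAt_sin t).pow 2).mul_const A).add
    (((Real.hasDerivAt_cos t).pow 2).mul_const B)).sub
    ((((Real.hasDerivAt_cos t).const_mul 2).mul (Real.hasDerivAt_sin t)).mul_const R)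
  refine HasDerivAt.congr_deriv h ?_
  simp only [rotatedCross]; push_cast; ring

lemma hasDerivAt_rotatedCross (t A B R : ℝ) :
    HasDerivAt (fun x => rotatedCross x A B R) (rotatedSnd t A B R - rotatedFst t A B R) t := by
  have h := ((((Real.hasDerivAt_cos t).pow 2).sub ((Real.hasDerivAt_sin t).pow 2)).mul_const
    R).add (((Real.hasDerivAt_cos t).mul (Real.hasDerivAt_sin t)).mul_const (B - A))
  refine HasDerivAt.congr_deriv h ?_
  simp only [rotatedFst, rotatedSnd]; push_cast; ring

variable [Fintype ι] [DecidableEq ι]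

lemma normSq_planeRotation_left (a b : ι) (t : ℝ) (v : ι → ℂ) :
    Complex.normSq ((planeRotation a b t *ᵥ v) a) =
      rotatedFst t (Complex.normSq (v a)) (Complex.normSq (v b)) (crossRe v a b) := by
  rw [planeRotation_mulVec, if_pos rfl]
  simp only [rotatedFst, Complex.normSq_apply, crossRe, Complex.add_re, Complex.add_im,
    Complex.re_ofReal_mul, Complex.im_ofReal_mul]
  ring

lemma normSq_planeRotation_right {a b : ι} (hab : a ≠ b) (t : ℝ) (v : ι → ℂ) :
    Complex.normSq ((planeRotation a b t *ᵥ v) b) =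
      rotatedSnd t (Complex.normSq (v a)) (Complex.normSq (v b)) (crossRe v a b) := by
  rw [planeRotation_mulVec, if_neg hab.symm, if_pos rfl, ← Complex.ofReal_neg]
  simp only [rotatedSnd, Complex.normSq_apply, crossRe, Complex.add_re, Complex.add_im,
    Complex.re_ofReal_mul, Complex.im_ofReal_mul]
  ring

lemma crossRe_planeRotation {a b : ι} (hab : a ≠ b) (t : ℝ) (v : ι → ℂ) :
    crossRe (planeRotation a b t *ᵥ v) a b =
      rotatedCross t (Complex.normSq (v a)) (Complex.normSq (v b)) (crossRe v a b) := by
  rw [crossRe, planeRotation_mulVec, planeRotation_mulVec, if_pos rfl, if_neg hab.symm, if_pos rfl,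
    ← Complex.ofReal_neg]
  simp only [rotatedCross, Complex.normSq_apply, crossRe, Complex.add_re, Complex.add_im,
    Complex.re_ofReal_mul, Complex.im_ofReal_mul]
  ring

namespace IsInvariantLaw

variable {ν : Measure (ι → ℂ)}

/-- A phase `i` on the coordinate `b` turns the real part of `v a * conj (v b)` into its imaginary
part, so both have the same second moment. -/
lemma integral_mul_crossRe_sq (hν : IsInvariantLaw ν) {a b : ι} (hab : a ≠ b) (p q : ℕ) :
    ∫ v, Complex.normSq (v a) ^ p * Complex.normSq (v b) ^ q * crossRe v a b ^ 2 ∂ν =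
      (∫ v, Complex.normSq (v a) ^ (p + 1) * Complex.normSq (v b) ^ (q + 1) ∂ν) / 2 := by
  have h := hν.integral_mulVec (f := fun v => Complex.normSq (v a) ^ p * Complex.normSq (v b) ^ q
    * crossRe v a b ^ 2) (by fun_prop) (phaseMatrix_mem b)
  have hsum : (fun v : ι → ℂ => Complex.normSq (v a) ^ (p + 1) * Complex.normSq (v b) ^ (q + 1)) =
      fun v => Complex.normSq (v a) ^ p * Complex.normSq (v b) ^ q * crossRe v a b ^ 2 +
        Complex.normSq ((phaseMatrix b *ᵥ v) a) ^ p * Complex.normSq ((phaseMatrix b *ᵥ v) b) ^ q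
          * crossRe (phaseMatrix b *ᵥ v) a b ^ 2 := by
    funext v
    simp only [crossRe, phaseMatrix_mulVec, if_neg hab, if_true, one_mul, map_mul,
      Complex.normSq_I, pow_succ, Complex.I_mul_re, Complex.I_mul_im]
    simp only [Complex.normSq_apply]
    ring
  rw [hsum, integral_add (hν.integrable (by fun_prop)) (hν.integrable ?_)]
  · linarith
  · have hV : Continuous fun v : ι → ℂ => phaseMatrix b *ᵥ v := by fun_prop
    have hc : Continuous fun v : ι → ℂ => Complex.normSq (v a) ^ p * Complex.normSq (v b) ^ q
      * crossRe v a b ^ 2 := by fun_prop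
    exact hc.comp hV

lemma hasDerivAt_integral (hν : IsInvariantLaw ν) {F F' : ℝ → (ι → ℂ) → ℝ}
    (hF : Continuous (Function.uncurry F)) (hF' : Continuous (Function.uncurry F'))
    (hd : ∀ t v, HasDerivAt (fun x => F x v) (F' t v) t) (t₀ : ℝ) :
    HasDerivAt (fun t => ∫ v, F t v ∂ν) (∫ v, F' t₀ v ∂ν) t₀ := by
  have := hν.prob
  obtain ⟨C, hC⟩ := ((isCompact_Icc (a := t₀ - 1) (b := t₀ + 1)).prod
    (isCompact_unitVectors (ι := ι))).exists_bound_of_continuousOn hF'.continuousOn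
  have cF (t : ℝ) : Continuous (F t) := hF.comp (Continuous.prodMk_right t)
  have cF' (t : ℝ) : Continuous (F' t) := hF'.comp (Continuous.prodMk_right t)
  exact (hasDerivAt_integral_of_dominated_loc_of_deriv_le (μ := ν) (F := F) (F' := F')
    (x₀ := t₀) (s := Set.Icc (t₀ - 1) (t₀ + 1)) (bound := fun _ => C)
    (Icc_mem_nhds (by linarith) (by linarith))
    (Filter.Eventually.of_forall fun t => (cF t).aestronglyMeasurable)
    (hν.integrable (cF t₀)) (cF' t₀).aestronglyMeasurable
    (by filter_upwards [hν.unit_norm] with v hv t ht using hC (t, v) ⟨ht, hv⟩)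
    (integrable_const C) (Filter.Eventually.of_forall fun v t _ => hd t v)).2

/-- Infinitesimal rotation invariance. With `A = |v a|²`, `B = |v b|²`, `R = Re (v a * conj (v b))`,
a rotation of the `(a, b)` plane has `A' = 2 R`, `B' = -2 R`, `R' = B - A`, and the mean of
`A ^ p B ^ q R` does not change. -/
lemma moment_recurrence (hν : IsInvariantLaw ν) {a b : ι} (hab : a ≠ b) (p q : ℕ) :
    (p + 1) * ∫ v, Complex.normSq (v a) ^ p * Complex.normSq (v b) ^ (q + 1) ∂ν =
      (q + 1) * ∫ v, Complex.normSq (v a) ^ (p + 1) * Complex.normSq (v b) ^ q ∂ν := by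
  have hderiv := hν.hasDerivAt_integral
    (F := fun t v => rotatedFst t (Complex.normSq (v a)) (Complex.normSq (v b)) (crossRe v a b) ^ p
      * rotatedSnd t (Complex.normSq (v a)) (Complex.normSq (v b)) (crossRe v a b) ^ q
      * rotatedCross t (Complex.normSq (v a)) (Complex.normSq (v b)) (crossRe v a b))
    (by simp only [Function.uncurry_def, rotatedFst, rotatedSnd, rotatedCross]; fun_prop)
    (by simp only [Function.uncurry_def, Pi.pow_apply, Pi.mul_apply, rotatedFst, rotatedSnd,
      rotatedCross]; fun_prop)
    (fun t v => (((hasDerivAt_rotatedFst t _ _ _).pow p).mul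
      ((hasDerivAt_rotatedSnd t _ _ _).pow q)).mul (hasDerivAt_rotatedCross t _ _ _)) 0
  have hconst (t : ℝ) : ∫ v, rotatedFst t (Complex.normSq (v a)) (Complex.normSq (v b))
        (crossRe v a b) ^ p
      * rotatedSnd t (Complex.normSq (v a)) (Complex.normSq (v b)) (crossRe v a b) ^ q
      * rotatedCross t (Complex.normSq (v a)) (Complex.normSq (v b)) (crossRe v a b) ∂ν =
      ∫ v, Complex.normSq (v a) ^ p * Complex.normSq (v b) ^ q * crossRe v a b ∂ν := by
    rw [← hν.integral_mulVec (f := fun v => Complex.normSq (v a) ^ p * Complex.normSq (v b) ^ q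
      * crossRe v a b) (by fun_prop) (planeRotation_mem hab t)]
    simp only [normSq_planeRotation_left, normSq_planeRotation_right hab,
      crossRe_planeRotation hab]
  rw [funext hconst] at hderiv
  have hzero := hderiv.unique (hasDerivAt_const _ _)
  simp only [Pi.pow_apply, Pi.mul_apply, rotatedFst_zero, rotatedSnd_zero, rotatedCross_zero]
    at hzero
  have hexp : ∀ v : ι → ℂ,
      (p * Complex.normSq (v a) ^ (p - 1) * (2 * crossRe v a b) * Complex.normSq (v b) ^ q
        + Complex.normSq (v a) ^ p * (q * Complex.normSq (v b) ^ (q - 1) * (-2 * crossRe v a b)))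
        * crossRe v a b
      + Complex.normSq (v a) ^ p * Complex.normSq (v b) ^ q
        * (Complex.normSq (v b) - Complex.normSq (v a)) =
      (2 * p) * (Complex.normSq (v a) ^ (p - 1) * Complex.normSq (v b) ^ q * crossRe v a b ^ 2)
      - (2 * q) * (Complex.normSq (v a) ^ p * Complex.normSq (v b) ^ (q - 1) * crossRe v a b ^ 2)
      + (Complex.normSq (v a) ^ p * Complex.normSq (v b) ^ (q + 1)
        - Complex.normSq (v a) ^ (p + 1) * Complex.normSq (v b) ^ q) := fun v => by ring
  have hzero' : ∫ v : ι → ℂ, ((2 * p) *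
      (Complex.normSq (v a) ^ (p - 1) * Complex.normSq (v b) ^ q * crossRe v a b ^ 2)
      - (2 * q) * (Complex.normSq (v a) ^ p * Complex.normSq (v b) ^ (q - 1) * crossRe v a b ^ 2)
      + (Complex.normSq (v a) ^ p * Complex.normSq (v b) ^ (q + 1)
        - Complex.normSq (v a) ^ (p + 1) * Complex.normSq (v b) ^ q)) ∂ν = 0 := by
    rw [← hzero]
    exact integral_congr_ae (Filter.Eventually.of_forall fun v => (hexp v).symm)
  rw [integral_add (hν.integrable (by fun_prop)) (hν.integrable (by fun_prop)),
    integral_sub (hν.integrable (by fun_prop)) (hν.integrable (by fun_prop)),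
    integral_sub (hν.integrable (by fun_prop)) (hν.integrable (by fun_prop)),
    integral_const_mul, integral_const_mul, hν.integral_mul_crossRe_sq hab,
    hν.integral_mul_crossRe_sq hab] at hzero'
  -- the exponents `p - 1` and `q - 1` occur with the factors `p` and `q`
  have hp : (p : ℝ) * ∫ v, Complex.normSq (v a) ^ (p - 1 + 1) * Complex.normSq (v b) ^ (q + 1) ∂ν
      = p * ∫ v, Complex.normSq (v a) ^ p * Complex.normSq (v b) ^ (q + 1) ∂ν := by
    cases p <;> simp
  have hq : (q : ℝ) * ∫ v, Complex.normSq (v a) ^ (p + 1) * Complex.normSq (v b) ^ (q - 1 + 1) ∂ν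
      = q * ∫ v, Complex.normSq (v a) ^ (p + 1) * Complex.normSq (v b) ^ q ∂ν := by
    cases q <;> simp
  linarith

/-- Multiplying by `∑ b, |v b|² = 1` relates consecutive moments of one coordinate. -/
lemma moment_succ (hν : IsInvariantLaw ν) (a : ι) (k : ℕ) :
    (Fintype.card ι + k) * ∫ v, Complex.normSq (v a) ^ (k + 1) ∂ν =
      (k + 1) * ∫ v, Complex.normSq (v a) ^ k ∂ν := by
  have h1 : ∫ v, Complex.normSq (v a) ^ k ∂ν =
      ∑ b, ∫ v, Complex.normSq (v a) ^ k * Complex.normSq (v b) ∂ν := by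
    rw [← integral_finsetSum _ fun b _ => hν.integrable (by fun_prop)]
    refine integral_congr_ae ?_
    filter_upwards [hν.unit_norm] with v hv
    rw [← Finset.mul_sum, hv, mul_one]
  have h2 (b : ι) (hb : b ∈ Finset.univ.erase a) :
      (k + 1) * ∫ v, Complex.normSq (v a) ^ k * Complex.normSq (v b) ∂ν =
        ∫ v, Complex.normSq (v a) ^ (k + 1) ∂ν := by
    simpa using hν.moment_recurrence (Finset.ne_of_mem_erase hb).symm k 0
  rw [h1, Finset.mul_sum, ← Finset.add_sum_erase _ _ (Finset.mem_univ a), Finset.sum_congr rfl h2,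
    Finset.sum_const, Finset.card_erase_of_mem (Finset.mem_univ a), Finset.card_univ, nsmul_eq_mul,
    Nat.cast_sub (Fintype.card_pos_iff.mpr ⟨a⟩)]
  simp only [← pow_succ]
  push_cast
  ring

lemma card_pos (_ : IsInvariantLaw ν) (a : ι) : (0 : ℝ) < Fintype.card ι :=
  Nat.cast_pos.mpr (Fintype.card_pos_iff.mpr ⟨a⟩)

lemma moment_one (hν : IsInvariantLaw ν) (a : ι) :
    ∫ v, Complex.normSq (v a) ∂ν = 1 / Fintype.card ι := by
  have := hν.prob
  have h := hν.moment_succ a 0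
  have hd := hν.card_pos a
  simp only [zero_add, pow_one, pow_zero, integral_const, probReal_univ, smul_eq_mul, mul_one,
    Nat.cast_zero, add_zero] at h
  field_simp
  linarith

lemma moment_two (hν : IsInvariantLaw ν) (a : ι) :
    ∫ v, Complex.normSq (v a) ^ 2 ∂ν = 2 / (Fintype.card ι * (Fintype.card ι + 1)) := by
  have h := hν.moment_succ a 1
  have hd := hν.card_pos a
  simp only [pow_one, hν.moment_one a, Nat.cast_one] at h
  rw [eq_div_iff (by positivity), ← mul_left_inj' hd.ne', ← sub_eq_zero]
  field_simp at h
  linear_combination (Fintype.card ι : ℝ) * h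

lemma moment_three (hν : IsInvariantLaw ν) (a : ι) :
    ∫ v, Complex.normSq (v a) ^ 3 ∂ν =
      6 / (Fintype.card ι * (Fintype.card ι + 1) * (Fintype.card ι + 2)) := by
  have h := hν.moment_succ a 2
  have hd := hν.card_pos a
  rw [hν.moment_two a] at h
  push_cast at h
  rw [← mul_right_inj' (by positivity : (Fintype.card ι + 2 : ℝ) ≠ 0), h]
  field_simp
  norm_num

lemma moment_four (hν : IsInvariantLaw ν) (a : ι) :
    ∫ v, Complex.normSq (v a) ^ 4 ∂ν = 24 / (Fintype.card ι * (Fintype.card ι + 1) *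
      (Fintype.card ι + 2) * (Fintype.card ι + 3)) := by
  have h := hν.moment_succ a 3
  have hd := hν.card_pos a
  rw [hν.moment_three a] at h
  push_cast at h
  rw [← mul_right_inj' (by positivity : (Fintype.card ι + 3 : ℝ) ≠ 0), h]
  field_simp
  norm_num

lemma moment_one_one (hν : IsInvariantLaw ν) {a b : ι} (hab : a ≠ b) :
    ∫ v, Complex.normSq (v a) * Complex.normSq (v b) ∂ν =
      1 / (Fintype.card ι * (Fintype.card ι + 1)) := by
  have h := hν.moment_recurrence hab 1 0
  simp only [pow_one, pow_zero, mul_one, zero_add, one_mul, Nat.cast_one, Nat.cast_zero,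
    Nat.reduceAdd, hν.moment_two a] at h
  have hd := hν.card_pos a
  field_simp at h ⊢
  linarith

lemma moment_two_two (hν : IsInvariantLaw ν) {a b : ι} (hab : a ≠ b) :
    ∫ v, Complex.normSq (v a) ^ 2 * Complex.normSq (v b) ^ 2 ∂ν =
      4 / (Fintype.card ι * (Fintype.card ι + 1) *
        (Fintype.card ι + 2) * (Fintype.card ι + 3)) := by
  have h1 := hν.moment_recurrence hab 2 1
  have h2 := hν.moment_recurrence hab 3 0
  simp only [pow_one, pow_zero, mul_one, zero_add, one_mul, Nat.cast_one, Nat.cast_zero,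
    Nat.reduceAdd, hν.moment_four a] at h1 h2
  push_cast at h1 h2
  have hd := hν.card_pos a
  have h3 : ∫ v, Complex.normSq (v a) ^ 2 * Complex.normSq (v b) ^ 2 ∂ν =
      24 / (Fintype.card ι * (Fintype.card ι + 1) *
        (Fintype.card ι + 2) * (Fintype.card ι + 3)) / 6 := by linarith
  rw [h3]
  ring

end IsInvariantLaw

end Moments

section TensorMoment

variable {ι : Type*} [Fintype ι] [DecidableEq ι] {ν : Measure (ι → ℂ)}

/-- The second moment tensor of an invariant law. The diagonal phases kill every entry in which the
indices without conjugation are not those with conjugation, up to order. -/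
lemma IsInvariantLaw.integral_tensor (hν : IsInvariantLaw ν) (i j k l : ι) :
    ∫ v, v i * star (v j) * v k * star (v l) ∂ν =
      ((if i = j ∧ k = l then 1 else 0) + (if i = l ∧ j = k then 1 else 0)) /
        (Fintype.card ι * (Fintype.card ι + 1)) := by
  -- multiplying the coordinate `s` by `i` multiplies the entry by a power of `i`
  have hphase (s : ι) : ∫ v, v i * star (v j) * v k * star (v l) ∂ν =
      ((if i = s then Complex.I else 1) * star (if j = s then Complex.I else 1) *
        (if k = s then Complex.I else 1) * star (if l = s then Complex.I else 1)) *
        ∫ v, v i * star (v j) * v k * star (v l) ∂ν := by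
    rw [← integral_const_mul]
    conv_lhs => rw [← hν.integral_mulVec (f := fun v : ι → ℂ => v i * star (v j) * v k * star (v l))
      (by fun_prop) (phaseMatrix_mem s)]
    congr 1
    funext v
    simp only [phaseMatrix_mulVec, star_mul']
    ring
  have hzero {z w : ℂ} (h : w = z * w) (hz : z ≠ 1) : w = 0 := by
    have : (z - 1) * w = 0 := by linear_combination -h
    exact (mul_eq_zero.mp this).resolve_left (sub_ne_zero.mpr hz)
  have hI : Complex.I ≠ 1 := fun h => by simpa using congrArg Complex.im h
  have hI' : -Complex.I ≠ 1 := fun h => by simpa using congrArg Complex.im h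
  have hreal (b c : ι) : ∫ v : ι → ℂ, v b * star (v b) * v c * star (v c) ∂ν =
      ((∫ v : ι → ℂ, Complex.normSq (v b) * Complex.normSq (v c) ∂ν : ℝ) : ℂ) := by
    rw [← integral_complex_ofReal]
    congr 1
    funext v
    push_cast
    rw [Complex.normSq_eq_conj_mul_self, Complex.normSq_eq_conj_mul_self]
    simp only [RCLike.star_def]
    ring
  have hoff {b c : ι} (hbc : b ≠ c) : ∫ v : ι → ℂ, v b * star (v b) * v c * star (v c) ∂ν =
      1 / (Fintype.card ι * (Fintype.card ι + 1)) := by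
    rw [hreal, hν.moment_one_one hbc]
    push_cast
    rfl
  by_cases hij : i = j
  · subst hij
    by_cases hkl : k = l
    · subst hkl
      by_cases hik : i = k
      · subst hik
        have h2 := hν.moment_two i
        simp only [pow_two] at h2
        rw [hreal, h2]
        push_cast
        norm_num
      · rw [hoff hik]
        simp [hik]
    · have h1 : ¬ (i = l ∧ i = k) := fun h => hkl (h.2.symm.trans h.1)
      rw [hzero (hphase l) ?_]
      · simp [hkl, h1]
      · by_cases hil : i = l <;> simp [hil, hkl, hI']
  · by_cases hil : i = l
    · subst hil
      by_cases hjk : j = k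
      · subst hjk
        have h : (fun v : ι → ℂ => v i * star (v j) * v j * star (v i)) =
            fun v => v i * star (v i) * v j * star (v j) := by funext v; ring
        rw [h, hoff hij]
        simp [hij]
      · rw [hzero (hphase j) ?_]
        · simp [hij, hjk]
        · simp [hij, Ne.symm hjk, hI']
    · rw [hzero (hphase i) ?_]
      · simp [hij, hil]
      · by_cases hki : k = i
        · simp only [hki, if_true, if_neg (Ne.symm hij), if_neg (Ne.symm hil), star_one, mul_one,
            Complex.I_mul_I]
          norm_num
        · simp [Ne.symm hij, Ne.symm hil, hki, hI]

end TensorMoment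

/-! ### The Haar measure of the unitary group and its columns and rows -/

instance instIsHaarMeasureHaarUnitary (n : ℕ) : (haarUnitary n).IsHaarMeasure := by
  unfold haarUnitary; infer_instance

instance instIsProbabilityMeasureHaarUnitary (n : ℕ) : IsProbabilityMeasure (haarUnitary n) :=
  ⟨by simpa [haarUnitary] using
    Measure.haarMeasure_self (K₀ := (⊤ : TopologicalSpace.PositiveCompacts (UGroup n)))⟩

/-- A compact group is unimodular. -/
lemma haarUnitary_map_mul_right {n : ℕ} (V : UGroup n) :
    (haarUnitary n).map (fun U => U * V) = haarUnitary n := by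
  have := Measure.isProbabilityMeasure_map (μ := haarUnitary n)
    (f := fun U => U * V) (by fun_prop)
  have := Measure.isHaarMeasure_map_mul_right (haarUnitary n) V
  exact Measure.isHaarMeasure_eq_of_isProbabilityMeasure _ _

lemma integrable_unitaryGroup {n : ℕ} {E : Type*} [NormedAddCommGroup E] {μ : Measure (UGroup n)}
    [IsFiniteMeasure μ] {f : UGroup n → E} (hf : Continuous f) : Integrable f μ :=
  hf.integrable_of_hasCompactSupport (HasCompactSupport.of_compactSpace f)

@[fun_prop]
lemma continuous_unitaryGroup_entry {n : ℕ} (a b : Bits n) :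
    Continuous fun U : UGroup n => (U : Op n) a b :=
  continuous_subtype_val.matrix_elem a b

lemma sum_normSq_mulVec {n : ℕ} (U : UGroup n) (ψ : Bits n → ℂ) :
    ∑ a, Complex.normSq (((U : Op n) *ᵥ ψ) a) = ∑ a, Complex.normSq (ψ a) := by
  have h (w : Bits n → ℂ) : ((∑ a, Complex.normSq (w a) : ℝ) : ℂ) = star w ⬝ᵥ w := by
    simp [dotProduct, Complex.normSq_eq_conj_mul_self]
  have h2 : star (U : Op n) * (U : Op n) = 1 := Matrix.mem_unitaryGroup_iff'.mp U.2
  have h3 : star ((U : Op n) *ᵥ ψ) ⬝ᵥ ((U : Op n) *ᵥ ψ) = star ψ ⬝ᵥ ψ := by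
    rw [Matrix.star_mulVec, Matrix.dotProduct_mulVec, Matrix.vecMul_vecMul,
      ← Matrix.star_eq_conjTranspose, h2, Matrix.vecMul_one]
  exact_mod_cast (h _).trans (h3.trans (h ψ).symm)

lemma haarState_isInvariantLaw (n : ℕ) : IsInvariantLaw (haarState n) := by
  have hm : Measurable fun U : UGroup n => (U : Op n) *ᵥ (Pi.single 0 1 : Bits n → ℂ) :=
    Continuous.measurable (by fun_prop)
  refine ⟨Measure.isProbabilityMeasure_map hm.aemeasurable, fun V hV => ?_, ?_⟩
  · rw [haarState, Measure.map_map (by fun_prop) hm]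
    conv_rhs => rw [← map_mul_left_eq_self (haarUnitary n) ⟨V, hV⟩,
      Measure.map_map hm (by fun_prop)]
    congr 1
    funext U
    exact Matrix.mulVec_mulVec _ _ _
  · rw [haarState, ae_map_iff hm.aemeasurable
      (measurableSet_eq_fun (by fun_prop) measurable_const)]
    refine Filter.Eventually.of_forall fun U => ?_
    rw [sum_normSq_mulVec]
    simp [Pi.single_apply, apply_ite Complex.normSq]

/-- The law of a row of a Haar random unitary. -/
lemma rowLaw_isInvariantLaw {n : ℕ} (a : Bits n) :
    IsInvariantLaw ((haarUnitary n).map fun (U : UGroup n) b => (U : Op n) a b) := by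
  have hm : Measurable fun (U : UGroup n) b => (U : Op n) a b :=
    Continuous.measurable (continuous_pi fun b => continuous_unitaryGroup_entry a b)
  refine ⟨Measure.isProbabilityMeasure_map hm.aemeasurable, fun V hV => ?_, ?_⟩
  · have hVt : Vᵀ ∈ Matrix.unitaryGroup (Bits n) ℂ := by
      rw [Matrix.mem_unitaryGroup_iff]
      have h := Matrix.mem_unitaryGroup_iff'.mp hV
      have h2 := congrArg Matrix.transpose h
      rwa [Matrix.transpose_mul, Matrix.transpose_one] at h2
    rw [Measure.map_map (by fun_prop) hm]
    conv_rhs => rw [← haarUnitary_map_mul_right ⟨Vᵀ, hVt⟩, Measure.map_map hm (by fun_prop)]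
    congr 1
    funext U b
    simp [Function.comp, Matrix.mul_apply, Matrix.mulVec, dotProduct, mul_comm]
  · rw [ae_map_iff hm.aemeasurable (measurableSet_eq_fun (by fun_prop) measurable_const)]
    refine Filter.Eventually.of_forall fun U => ?_
    have h : ((U : Op n) * star (U : Op n)) a a = 1 := by
      rw [Matrix.mem_unitaryGroup_iff.mp U.2, Matrix.one_apply_eq]
    rw [Matrix.mul_apply] at h
    have h2 : ((∑ b, Complex.normSq ((U : Op n) a b) : ℝ) : ℂ) = 1 := by
      rw [← h]
      push_cast
      refine Finset.sum_congr rfl fun b _ => ?_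
      rw [Complex.normSq_eq_conj_mul_self, mul_comm, Matrix.star_apply, RCLike.star_def]
    exact_mod_cast h2

/-! ### Unitary 2-designs -/

lemma IsUnitaryDesign.integral_row_tensor {n : ℕ} {μ : Measure (UGroup n)}
    (hμ : IsUnitaryDesign μ 2) (a i j k l : Bits n) :
    ∫ U : UGroup n, (U : Op n) a i * star ((U : Op n) a j) * (U : Op n) a k
        * star ((U : Op n) a l) ∂μ =
      ((if i = j ∧ k = l then 1 else 0) + (if i = l ∧ j = k then 1 else 0)) /
        (2 ^ n * (2 ^ n + 1)) := by
  -- the channel applied to `|a a⟩⟨a a|`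
  have h := congrFun₂ (hμ (Matrix.single (fun _ => a) (fun _ => a) 1)) ![j, l] ![i, k]
  have hentry (U : UGroup n) : (tensorPower 2 (U : Op n)ᴴ *
      Matrix.single (fun _ => a) (fun _ => a) 1 * tensorPower 2 (U : Op n) :
        Matrix (Fin 2 → Bits n) (Fin 2 → Bits n) ℂ) ![j, l] ![i, k] =
      (U : Op n) a i * star ((U : Op n) a j) * (U : Op n) a k * star ((U : Op n) a l) := by
    rw [Matrix.mul_single_eq_updateCol_zero, Matrix.mul_apply,
      Finset.sum_eq_single (fun _ => a : Fin 2 → Bits n)]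
    · simp [tensorPower, Fin.prod_univ_two]
      ring
    · intro b _ hb
      simp [Matrix.updateCol_ne hb]
    · simp
  simp only [momentChannel, Matrix.of_apply, hentry] at h
  rw [h]
  have hr := (rowLaw_isInvariantLaw a).integral_tensor i j k l
  rw [integral_map
    (Continuous.aemeasurable (continuous_pi fun b => continuous_unitaryGroup_entry a b))
    (Continuous.aestronglyMeasurable (by fun_prop))] at hr
  rw [hr]
  simp [Bits, ZMod.card]

/-- The squared overlap `|⟨ψ|φ⟩|²`. -/
def overlap {n : ℕ} (ψ φ : Bits n → ℂ) : ℝ := Complex.normSq (ψ ⬝ᵥ star φ)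

lemma trace_ketbra_mul {n : ℕ} (ψ φ : Bits n → ℂ) :
    (ketbra ψ * ketbra φ).trace.re = overlap ψ φ := by
  have h : (ketbra ψ * ketbra φ).trace = (Complex.normSq (ψ ⬝ᵥ star φ) : ℂ) := by
    rw [ketbra, ketbra, Matrix.vecMulVec_mul_vecMulVec, Matrix.vecMulVec_smul, Matrix.trace_smul,
      Matrix.trace_vecMulVec,
      Complex.normSq_eq_conj_mul_self, smul_eq_mul]
    congr 1
    simp [dotProduct, mul_comm]
  rw [h, Complex.ofReal_re, overlap]

/-- The mean collision probability of a 2-design. -/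
lemma IsUnitaryDesign.integral_collision {n : ℕ} {μ : Measure (UGroup n)} [IsProbabilityMeasure μ]
    (hμ : IsUnitaryDesign μ 2) {ψ φ : Bits n → ℂ} (hψ : ∑ a, Complex.normSq (ψ a) = 1)
    (hφ : ∑ a, Complex.normSq (φ a) = 1) :
    ∫ U : UGroup n, ∑ a, Complex.normSq (((U : Op n) *ᵥ ψ) a)
      * Complex.normSq (((U : Op n) *ᵥ φ) a) ∂μ = (1 + overlap ψ φ) / (2 ^ n + 1) := by
  have hcoord (a : Bits n) : ∫ U : UGroup n, Complex.normSq (((U : Op n) *ᵥ ψ) a)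
      * Complex.normSq (((U : Op n) *ᵥ φ) a) ∂μ = (1 + overlap ψ φ) / (2 ^ n * (2 ^ n + 1)) := by
    have hexp (U : UGroup n) : ((Complex.normSq (((U : Op n) *ᵥ ψ) a)
        * Complex.normSq (((U : Op n) *ᵥ φ) a) : ℝ) : ℂ) =
        ∑ x : (Bits n × Bits n) × (Bits n × Bits n),
          (ψ x.1.1 * star (ψ x.1.2) * φ x.2.1 * star (φ x.2.2)) *
          ((U : Op n) a x.1.1 * star ((U : Op n) a x.1.2) * (U : Op n) a x.2.1
            * star ((U : Op n) a x.2.2)) := by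
      have hn (w : Bits n → ℂ) : (Complex.normSq (((U : Op n) *ᵥ w) a) : ℂ) =
          ∑ x : Bits n × Bits n,
            ((U : Op n) a x.1 * w x.1) * (star ((U : Op n) a x.2) * star (w x.2)) := by
        rw [Complex.normSq_eq_conj_mul_self, mul_comm, Fintype.sum_prod_type]
        simp only [Matrix.mulVec, dotProduct, map_sum, map_mul, Finset.sum_mul_sum, RCLike.star_def]
      push_cast
      rw [hn, hn, Finset.sum_mul_sum, ← Fintype.sum_prod_type']
      refine Finset.sum_congr rfl fun x _ => ?_
      ring
    have hint : ((∫ U : UGroup n, Complex.normSq (((U : Op n) *ᵥ ψ) a)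
        * Complex.normSq (((U : Op n) *ᵥ φ) a) ∂μ : ℝ) : ℂ) =
        (((1 + overlap ψ φ) / (2 ^ n * (2 ^ n + 1)) : ℝ) : ℂ) := by
      rw [← integral_complex_ofReal]
      simp only [hexp]
      rw [integral_finsetSum _ fun x _ => (integrable_unitaryGroup (by fun_prop)).const_mul _]
      simp only [integral_const_mul, hμ.integral_row_tensor, ← mul_div_assoc]
      rw [← Finset.sum_div]
      push_cast
      congr 1
      have h1 : ((∑ b, Complex.normSq (ψ b) : ℝ) : ℂ) *
          ((∑ b, Complex.normSq (φ b) : ℝ) : ℂ) = 1 := by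
        rw [hψ, hφ]; norm_num
      have h2 : (overlap ψ φ : ℂ) = ∑ b, ∑ c, ψ b * star (ψ c) * φ c * star (φ b) := by
        rw [overlap, Complex.normSq_eq_conj_mul_self, mul_comm]
        simp only [dotProduct, map_sum, map_mul, Finset.sum_mul_sum, RCLike.star_def, Pi.star_apply,
          Complex.conj_conj]
        refine Finset.sum_congr rfl fun b _ => Finset.sum_congr rfl fun c _ => ?_
        ring
      rw [h2]
      refine Eq.trans ?_ (congrArg (fun z : ℂ => z + _) h1)
      push_cast
      simp only [Complex.normSq_eq_conj_mul_self, Finset.sum_mul_sum]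
      simp only [Fintype.sum_prod_type, mul_add, Finset.sum_add_distrib, ite_and, mul_ite, mul_one,
        mul_zero, Finset.sum_ite_eq, Finset.mem_univ, if_true, Finset.sum_ite_irrel,
        Finset.sum_const_zero]
      congr 1
      refine Finset.sum_congr rfl fun b _ => Finset.sum_congr rfl fun c _ => ?_
      simp only [RCLike.star_def]
      ring
    exact_mod_cast hint
  rw [integral_finsetSum _ fun a _ => integrable_unitaryGroup (by fun_prop)]
  simp only [hcoord, Finset.sum_const, Finset.card_univ, nsmul_eq_mul]
  have hd : ((Fintype.card (Bits n) : ℕ) : ℝ) = 2 ^ n := by simp [Bits, ZMod.card]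
  rw [hd]
  field_simp

/-! ### Moments of sums over independent finite samples -/

section FiniteSamples

variable {α : Type*} [Fintype α]

lemma sum_fin_succ_fun {m : ℕ} (G : (Fin (m + 1) → α) → ℝ) :
    ∑ a, G a = ∑ x, ∑ a : Fin m → α, G (Fin.cons x a) := by
  rw [← Fintype.sum_prod_type' fun x (a : Fin m → α) => G (Fin.cons x a)]
  exact (Fintype.sum_equiv (Fin.consEquiv fun _ => α) _ _ fun _ => rfl).symm

lemma sum_prod_eq_one {p : α → ℝ} (hp : ∑ x, p x = 1) (m : ℕ) :
    ∑ a : Fin m → α, ∏ i, p (a i) = 1 := by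
  rw [← Fintype.piFinset_univ, ← Finset.prod_univ_sum]
  simp [hp]

lemma sum_prod_mul_sum {p : α → ℝ} (hp : ∑ x, p x = 1) (F : α → ℝ) (m : ℕ) :
    ∑ a : Fin m → α, (∏ i, p (a i)) * ∑ i, F (a i) = m * ∑ x, p x * F x := by
  induction m with
  | zero => simp
  | succ m ih =>
    have h (x : α) (a : Fin m → α) : (p x * ∏ i, p (a i)) * (F x + ∑ i, F (a i)) =
        (p x * F x) * ∏ i, p (a i) + p x * ((∏ i, p (a i)) * ∑ i, F (a i)) := by ring
    rw [sum_fin_succ_fun]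
    simp only [Fin.prod_univ_succ, Fin.sum_univ_succ, Fin.cons_zero, Fin.cons_succ, h,
      Finset.sum_add_distrib, ← Finset.mul_sum, ih, sum_prod_eq_one hp]
    simp only [← Finset.sum_mul, hp]
    push_cast
    ring

/-- The second moment of a sum over `m` independent samples. -/
lemma sum_prod_mul_sum_sq {p : α → ℝ} (hp : ∑ x, p x = 1) (F : α → ℝ) (m : ℕ) :
    ∑ a : Fin m → α, (∏ i, p (a i)) * (∑ i, F (a i)) ^ 2 =
      m * ∑ x, p x * F x ^ 2 + m * (m - 1) * (∑ x, p x * F x) ^ 2 := by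
  induction m with
  | zero => simp
  | succ m ih =>
    have h (x : α) (a : Fin m → α) : (p x * ∏ i, p (a i)) * (F x + ∑ i, F (a i)) ^ 2 =
        (p x * F x ^ 2) * ∏ i, p (a i) + 2 * (p x * F x) * ((∏ i, p (a i)) * ∑ i, F (a i)) +
          p x * ((∏ i, p (a i)) * (∑ i, F (a i)) ^ 2) := by ring
    rw [sum_fin_succ_fun]
    simp only [Fin.prod_univ_succ, Fin.sum_univ_succ, Fin.cons_zero, Fin.cons_succ, h,
      Finset.sum_add_distrib, ← Finset.mul_sum, ih, sum_prod_eq_one hp, sum_prod_mul_sum hp]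
    simp only [← Finset.sum_mul, ← Finset.mul_sum, hp]
    push_cast
    ring

lemma sum_prod_mul_double_sum {p q : α → ℝ} (hp : ∑ x, p x = 1) (hq : ∑ x, q x = 1)
    (f : α → α → ℝ) (m : ℕ) :
    ∑ o : (Fin m → α) × (Fin m → α), ((∏ i, p (o.1 i)) * ∏ j, q (o.2 j)) *
      ∑ i, ∑ j, f (o.1 i) (o.2 j) = m ^ 2 * ∑ x, p x * ∑ y, q y * f x y := by
  rw [Fintype.sum_prod_type]
  have h (a : Fin m → α) : ∑ b : Fin m → α, ((∏ i, p (a i)) * ∏ j, q (b j)) *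
      ∑ i, ∑ j, f (a i) (b j) = m * ((∏ i, p (a i)) * ∑ i, ∑ y, q y * f (a i) y) := by
    have h1 := sum_prod_mul_sum hq (fun y => ∑ i, f (a i) y) m
    have h2 (b : Fin m → α) : ∑ i, ∑ j, f (a i) (b j) = ∑ j, ∑ i, f (a i) (b j) :=
      Finset.sum_comm
    have h3 : ∑ i, ∑ y, q y * f (a i) y = ∑ y, q y * ∑ i, f (a i) y := by
      rw [Finset.sum_comm]
      simp only [← Finset.mul_sum]
    simp only [mul_assoc, ← Finset.mul_sum, h2, h3, h1]
    rw [mul_left_comm]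
  simp only [h, ← Finset.mul_sum]
  rw [sum_prod_mul_sum hp fun x => ∑ y, q y * f x y]
  ring

/-- The second moment of a sum over all pairs from two independent samples, sorted by which indices
of two pairs coincide: both, one, or none. -/
lemma sum_prod_mul_double_sum_sq {p q : α → ℝ} (hp : ∑ x, p x = 1) (hq : ∑ x, q x = 1)
    (f : α → α → ℝ) (m : ℕ) :
    ∑ o : (Fin m → α) × (Fin m → α), ((∏ i, p (o.1 i)) * ∏ j, q (o.2 j)) *
      (∑ i, ∑ j, f (o.1 i) (o.2 j)) ^ 2 =
      m ^ 2 * (∑ y, q y * ∑ x, p x * f x y ^ 2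
        + (m - 1) * (∑ y, q y * (∑ x, p x * f x y) ^ 2 + ∑ x, p x * (∑ y, q y * f x y) ^ 2)
        + (m - 1) ^ 2 * (∑ x, p x * ∑ y, q y * f x y) ^ 2) := by
  rw [Fintype.sum_prod_type]
  have h (a : Fin m → α) : ∑ b : Fin m → α, ((∏ i, p (a i)) * ∏ j, q (b j)) *
      (∑ i, ∑ j, f (a i) (b j)) ^ 2 = ∑ y, m * q y * ((∏ i, p (a i)) * (∑ i, f (a i) y) ^ 2)
        + m * (m - 1) * ((∏ i, p (a i)) * (∑ i, ∑ y, q y * f (a i) y) ^ 2) := by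
    have h1 := sum_prod_mul_sum_sq hq (fun y => ∑ i, f (a i) y) m
    have h2 (b : Fin m → α) : ∑ i, ∑ j, f (a i) (b j) = ∑ j, ∑ i, f (a i) (b j) :=
      Finset.sum_comm
    have h3 : ∑ i, ∑ y, q y * f (a i) y = ∑ y, q y * ∑ i, f (a i) y := by
      rw [Finset.sum_comm]
      simp only [← Finset.mul_sum]
    simp only [mul_assoc, ← Finset.mul_sum, h2, h3, h1]
    simp only [Finset.mul_sum, mul_add]
    congr 1
    · exact Finset.sum_congr rfl fun y _ => by ring
    · ring
  simp only [h, Finset.sum_add_distrib]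
  rw [Finset.sum_comm]
  simp only [← Finset.mul_sum, fun y => sum_prod_mul_sum_sq hp (fun x => f x y) m,
    sum_prod_mul_sum_sq hp (fun x => ∑ y, q y * f x y) m]
  have h4 : ∑ y, m * q y * (m * ∑ x, p x * f x y ^ 2 + m * (m - 1) * (∑ x, p x * f x y) ^ 2) =
      m ^ 2 * ∑ y, q y * ∑ x, p x * f x y ^ 2
        + m ^ 2 * (m - 1) * ∑ y, q y * (∑ x, p x * f x y) ^ 2 := by
    rw [Finset.mul_sum, Finset.mul_sum, ← Finset.sum_add_distrib]
    exact Finset.sum_congr rfl fun y _ => by ring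
  rw [h4]
  ring

end FiniteSamples

/-! ### Moments of one round given the rotation -/

/-- The mean of `g` over one round's outcomes when the two states, rotated, are `w` and `z`. -/
def sampleMean {n m : ℕ} (g : Outcome n m → ℝ) (w z : Bits n → ℂ) : ℝ :=
  ∑ o : Outcome n m,
    ((∏ i, Complex.normSq (w (o.1 i))) * ∏ j, Complex.normSq (z (o.2 j))) * g o

lemma classicalFun_sum_left {n : ℕ} {q : Bits n → ℝ} (hq : ∑ b, q b = 1) (a : Bits n) :
    ∑ b, q b * classicalFun a b = (2 ^ n + 1) * q a - 1 := by
  have h (b : Bits n) : q b * classicalFun a b =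
      (if a = b then (2 ^ n + 1) * q b else 0) - q b := by
    unfold classicalFun
    split_ifs <;> ring
  simp [h, Finset.sum_sub_distrib, hq]

lemma classicalFun_comm {n : ℕ} (a b : Bits n) : classicalFun a b = classicalFun b a := by
  simp [classicalFun, eq_comm]

lemma classicalFun_sq_sum {n : ℕ} {q : Bits n → ℝ} (hq : ∑ b, q b = 1) (a : Bits n) :
    ∑ b, q b * classicalFun b a ^ 2 = ((2 ^ n) ^ 2 - 1) * q a + 1 := by
  have h (b : Bits n) : q b * classicalFun b a ^ 2 =
      (if b = a then ((2 ^ n) ^ 2 - 1) * q b else 0) + q b := by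
    unfold classicalFun
    split_ifs <;> ring
  simp [h, Finset.sum_add_distrib, hq]

lemma sampleMean_roundEstimator {n m : ℕ} (hm : 1 ≤ m) {w z : Bits n → ℂ}
    (hw : ∑ a, Complex.normSq (w a) = 1) (hz : ∑ a, Complex.normSq (z a) = 1) :
    sampleMean (m := m) roundEstimator w z =
      (2 ^ n + 1) * ∑ a, Complex.normSq (w a) * Complex.normSq (z a) - 1 := by
  have hm' : (m : ℝ) ≠ 0 := by positivity
  have h := sum_prod_mul_double_sum hw hz classicalFun m
  simp only [classicalFun_sum_left hz, mul_sub, mul_one, Finset.sum_sub_distrib, hw] at h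
  have h2 : sampleMean (m := m) roundEstimator w z = 1 / (m : ℝ) ^ 2 *
      ∑ o : Outcome n m, ((∏ i, Complex.normSq (w (o.1 i))) * ∏ j, Complex.normSq (z (o.2 j))) *
        ∑ i, ∑ j, classicalFun (o.1 i) (o.2 j) := by
    rw [sampleMean, Finset.mul_sum]
    exact Finset.sum_congr rfl fun o _ => by rw [roundEstimator]; ring
  rw [h2, h, mul_sub, ← mul_assoc, one_div_mul_cancel (pow_ne_zero 2 hm'), one_mul, Finset.mul_sum]
  congr 1
  exact Finset.sum_congr rfl fun a _ => by ring

/-- The bound on the conditional second moment of the estimator: the contributions of two equal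
pairs of shots, of pairs sharing one shot, and of disjoint pairs. -/
lemma sampleMean_roundEstimator_sq_le {n m : ℕ} (hm : 1 ≤ m) {w z : Bits n → ℂ}
    (hw : ∑ a, Complex.normSq (w a) = 1) (hz : ∑ a, Complex.normSq (z a) = 1) :
    sampleMean (m := m) (fun o => roundEstimator o ^ 2) w z ≤
      (1 + (2 ^ n) ^ 2 * ∑ a, Complex.normSq (w a) * Complex.normSq (z a)) / (m : ℝ) ^ 2
      + (2 + (2 ^ n + 1) ^ 2 * (∑ a, Complex.normSq (z a) * Complex.normSq (w a) ^ 2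
        + ∑ a, Complex.normSq (w a) * Complex.normSq (z a) ^ 2)) / (m : ℝ)
      + ((2 ^ n + 1) * ∑ a, Complex.normSq (w a) * Complex.normSq (z a) - 1) ^ 2 := by
  set S := ∑ a, Complex.normSq (w a) * Complex.normSq (z a) with hS
  have hS0 : 0 ≤ S := Finset.sum_nonneg fun a _ =>
    mul_nonneg (Complex.normSq_nonneg _) (Complex.normSq_nonneg _)
  have hm1 : (1 : ℝ) ≤ m := by exact_mod_cast hm
  have hm0 : (0 : ℝ) < m := by linarith
  have h := sum_prod_mul_double_sum_sq hw hz classicalFun m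
  have h2 : sampleMean (m := m) (fun o => roundEstimator o ^ 2) w z = (1 / (m : ℝ) ^ 2) ^ 2 *
      ∑ o : Outcome n m, ((∏ i, Complex.normSq (w (o.1 i))) * ∏ j, Complex.normSq (z (o.2 j))) *
        (∑ i, ∑ j, classicalFun (o.1 i) (o.2 j)) ^ 2 := by
    rw [sampleMean, Finset.mul_sum]
    exact Finset.sum_congr rfl fun o _ => by rw [roundEstimator]; ring
  have hleft (b : Bits n) : ∑ a, Complex.normSq (w a) * classicalFun a b =
      (2 ^ n + 1) * Complex.normSq (w b) - 1 := by
    simp only [classicalFun_comm _ b, classicalFun_sum_left hw]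
  have e1 : ∑ b, Complex.normSq (z b) * (((2 ^ n) ^ 2 - 1) * Complex.normSq (w b) + 1) =
      ((2 ^ n) ^ 2 - 1) * S + 1 := by
    simp only [mul_add, mul_one, Finset.sum_add_distrib, hz, hS, Finset.mul_sum]
    congr 1
    exact Finset.sum_congr rfl fun a _ => by ring
  have e2 (u v : Bits n → ℂ) (hu : ∑ a, Complex.normSq (u a) = 1) :
      ∑ b, Complex.normSq (u b) * ((2 ^ n + 1) * Complex.normSq (v b) - 1) ^ 2 ≤
        (2 ^ n + 1) ^ 2 * ∑ b, Complex.normSq (u b) * Complex.normSq (v b) ^ 2 + 1 := by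
    refine le_of_le_of_eq ?_ (congrArg (fun t : ℝ => _ + t) hu)
    rw [Finset.mul_sum, ← Finset.sum_add_distrib]
    refine Finset.sum_le_sum fun b _ => ?_
    have h1 : 0 ≤ (2 ^ n + 1 : ℝ) * (Complex.normSq (u b) * Complex.normSq (v b)) :=
      mul_nonneg (by positivity) (mul_nonneg (Complex.normSq_nonneg _) (Complex.normSq_nonneg _))
    linarith
  have e3 : ∑ a, Complex.normSq (w a) * ((2 ^ n + 1) * Complex.normSq (z a) - 1) =
      (2 ^ n + 1) * S - 1 := by
    simp only [mul_sub, mul_one, Finset.sum_sub_distrib, hw, hS, Finset.mul_sum]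
    congr 1
    exact Finset.sum_congr rfl fun a _ => by ring
  simp only [classicalFun_sq_sum hw, hleft, classicalFun_sum_left hz, e1, e3] at h
  have b1 := e2 z w hz
  have b2 := e2 w z hw
  set K1 := ∑ b, Complex.normSq (z b) * ((2 ^ n + 1) * Complex.normSq (w b) - 1) ^ 2
  set K2 := ∑ b, Complex.normSq (w b) * ((2 ^ n + 1) * Complex.normSq (z b) - 1) ^ 2
  have hK : 0 ≤ K1 + K2 := by
    refine add_nonneg ?_ ?_ <;>
      exact Finset.sum_nonneg fun a _ => mul_nonneg (Complex.normSq_nonneg _) (sq_nonneg _)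
  set g := (2 ^ n + 1) * S - 1
  have e4 : sampleMean (m := m) (fun o => roundEstimator o ^ 2) w z =
      (((2 ^ n) ^ 2 - 1) * S + 1) / (m : ℝ) ^ 2 + ((m - 1) / m) * ((K1 + K2) / m)
        + ((m - 1) / m) ^ 2 * g ^ 2 := by
    rw [h2, h]
    field_simp
  have hr0 : 0 ≤ ((m : ℝ) - 1) / m := div_nonneg (by linarith) hm0.le
  have hr1 : ((m : ℝ) - 1) / m ≤ 1 := by rw [div_le_one hm0]; linarith
  rw [e4]
  refine add_le_add (add_le_add ?_ ?_) ?_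
  · exact div_le_div_of_nonneg_right (by linarith) (by positivity)
  · refine (mul_le_of_le_one_left (div_nonneg hK hm0.le) hr1).trans ?_
    exact div_le_div_of_nonneg_right (by linarith) hm0.le
  · exact mul_le_of_le_one_left (sq_nonneg g) (pow_le_one₀ hr0 hr1)

/-! ### The law of one round on pure states -/

lemma bornProb_ketbra {n : ℕ} (U : UGroup n) (ψ : Bits n → ℂ) (a : Bits n) :
    bornProb U (ketbra ψ) a = Complex.normSq (((U : Op n) *ᵥ ψ) a) := by
  have h : (U : Op n) * ketbra ψ * (U : Op n)ᴴ =
      Matrix.vecMulVec ((U : Op n) *ᵥ ψ) (star ((U : Op n) *ᵥ ψ)) := by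
    rw [ketbra, Matrix.mul_vecMulVec, Matrix.vecMulVec_mul, Matrix.star_mulVec]
  rw [bornProb, h, Matrix.vecMulVec_apply, Pi.star_apply, RCLike.star_def, Complex.mul_conj,
    Complex.ofReal_re]

lemma roundProb_ketbra {n m : ℕ} (μ : Measure (UGroup n)) (ψ φ : Bits n → ℂ) (o : Outcome n m) :
    roundProb μ (ketbra ψ) (ketbra φ) o =
      ∫ U : UGroup n, (∏ i, Complex.normSq (((U : Op n) *ᵥ ψ) (o.1 i))) *
        ∏ j, Complex.normSq (((U : Op n) *ᵥ φ) (o.2 j)) ∂μ := by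
  simp only [roundProb, bornProb_ketbra]

lemma roundProb_ketbra_nonneg {n m : ℕ} (μ : Measure (UGroup n)) (ψ φ : Bits n → ℂ)
    (o : Outcome n m) : 0 ≤ roundProb μ (ketbra ψ) (ketbra φ) o := by
  rw [roundProb_ketbra]
  exact integral_nonneg fun U => mul_nonneg
    (Finset.prod_nonneg fun _ _ => Complex.normSq_nonneg _)
    (Finset.prod_nonneg fun _ _ => Complex.normSq_nonneg _)

lemma continuous_roundProb {n m : ℕ} (μ : Measure (UGroup n)) [IsFiniteMeasure μ]
    (o : Outcome n m) : Continuous fun p : (Bits n → ℂ) × (Bits n → ℂ) =>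
      roundProb μ (ketbra p.1) (ketbra p.2) o := by
  simp only [roundProb_ketbra]
  have h : Continuous (Function.uncurry fun (p : (Bits n → ℂ) × (Bits n → ℂ)) (U : UGroup n) =>
      (∏ i, Complex.normSq (((U : Op n) *ᵥ p.1) (o.1 i))) *
        ∏ j, Complex.normSq (((U : Op n) *ᵥ p.2) (o.2 j))) := by
    simp only [Function.uncurry_def]
    fun_prop
  simpa using continuous_parametric_integral_of_continuous (μ := μ) h isCompact_univ

instance instIsFiniteMeasureRoundLaw {n m : ℕ} (μ : Measure (UGroup n)) (ρ σ : Op n) :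
    IsFiniteMeasure (roundLaw μ ρ σ m) := by
  unfold roundLaw
  have (o : Outcome n m) : IsFiniteMeasure
      (ENNReal.ofReal (roundProb μ ρ σ o) • Measure.dirac o) :=
    Measure.smul_finite _ ENNReal.ofReal_ne_top
  infer_instance

lemma integral_roundLaw_eq_sum {n m : ℕ} (μ : Measure (UGroup n)) (ψ φ : Bits n → ℂ)
    (g : Outcome n m → ℝ) : ∫ o, g o ∂roundLaw μ (ketbra ψ) (ketbra φ) m =
      ∑ o, roundProb μ (ketbra ψ) (ketbra φ) o * g o := by
  rw [roundLaw, integral_finsetSum_measure]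
  · refine Finset.sum_congr rfl fun o _ => ?_
    rw [integral_smul_measure, integral_dirac,
      ENNReal.toReal_ofReal (roundProb_ketbra_nonneg μ ψ φ o), smul_eq_mul]
  · intro o _
    exact (integrable_dirac (by simp)).smul_measure ENNReal.ofReal_ne_top

lemma continuous_estimatorVariance {n : ℕ} (μ : Measure (UGroup n)) [IsFiniteMeasure μ] (m : ℕ) :
    Continuous fun p : (Bits n → ℂ) × (Bits n → ℂ) =>
      estimatorVariance μ m (ketbra p.1) (ketbra p.2) := by
  have h := fun o : Outcome n m => continuous_roundProb μ o
  simp only [estimatorVariance, variance_eq_integral (Measurable.of_discrete.aemeasurable),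
    integral_roundLaw_eq_sum]
  fun_prop

lemma continuous_sampleMean {n m : ℕ} (g : Outcome n m → ℝ) :
    Continuous fun p : (Bits n → ℂ) × (Bits n → ℂ) => sampleMean g p.1 p.2 := by
  unfold sampleMean
  fun_prop

lemma integral_roundLaw {n m : ℕ} (μ : Measure (UGroup n)) [IsFiniteMeasure μ]
    (ψ φ : Bits n → ℂ) (g : Outcome n m → ℝ) :
    ∫ o, g o ∂roundLaw μ (ketbra ψ) (ketbra φ) m =
      ∫ U : UGroup n, sampleMean g ((U : Op n) *ᵥ ψ) ((U : Op n) *ᵥ φ) ∂μ := by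
  rw [integral_roundLaw_eq_sum]
  simp only [sampleMean]
  rw [integral_finsetSum _ fun o _ => integrable_unitaryGroup (by fun_prop)]
  refine Finset.sum_congr rfl fun o _ => ?_
  rw [roundProb_ketbra, integral_mul_const]

lemma isProbabilityMeasure_roundLaw {n : ℕ} (μ : Measure (UGroup n)) [IsProbabilityMeasure μ]
    (m : ℕ) {ψ φ : Bits n → ℂ} (hψ : ∑ a, Complex.normSq (ψ a) = 1)
    (hφ : ∑ a, Complex.normSq (φ a) = 1) :
    IsProbabilityMeasure (roundLaw μ (ketbra ψ) (ketbra φ) m) := by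
  have h := integral_roundLaw μ ψ φ (fun _ : Outcome n m => (1 : ℝ))
  have h1 (U : UGroup n) : sampleMean (fun _ : Outcome n m => (1 : ℝ)) ((U : Op n) *ᵥ ψ)
      ((U : Op n) *ᵥ φ) = 1 := by
    simp only [sampleMean, mul_one]
    rw [Fintype.sum_prod_type]
    dsimp only
    rw [← Finset.sum_mul_sum, sum_prod_eq_one ((sum_normSq_mulVec U ψ).trans hψ),
      sum_prod_eq_one ((sum_normSq_mulVec U φ).trans hφ), one_mul]
  simp only [h1, integral_const, probReal_univ, smul_eq_mul, mul_one] at h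
  exact ⟨by simpa [Measure.real, ENNReal.toReal_eq_one_iff] using h⟩

/-- The one-round estimator is unbiased. -/
lemma IsUnitaryDesign.integral_roundEstimator {n m : ℕ} {μ : Measure (UGroup n)}
    [IsProbabilityMeasure μ] (hμ : IsUnitaryDesign μ 2) (hm : 1 ≤ m) {ψ φ : Bits n → ℂ}
    (hψ : ∑ a, Complex.normSq (ψ a) = 1) (hφ : ∑ a, Complex.normSq (φ a) = 1) :
    ∫ o, roundEstimator o ∂roundLaw μ (ketbra ψ) (ketbra φ) m = overlap ψ φ := by
  rw [integral_roundLaw]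
  simp only [fun U : UGroup n => sampleMean_roundEstimator hm ((sum_normSq_mulVec U ψ).trans hψ)
    ((sum_normSq_mulVec U φ).trans hφ)]
  rw [integral_sub ((integrable_unitaryGroup (by fun_prop)).const_mul _) (integrable_const _),
    integral_const_mul, hμ.integral_collision hψ hφ]
  simp only [integral_const, probReal_univ, smul_eq_mul, mul_one]
  field_simp
  ring

lemma IsUnitaryDesign.estimatorVariance_eq {n m : ℕ} {μ : Measure (UGroup n)}
    [IsProbabilityMeasure μ] (hμ : IsUnitaryDesign μ 2) (hm : 1 ≤ m) {ψ φ : Bits n → ℂ}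
    (hψ : ∑ a, Complex.normSq (ψ a) = 1) (hφ : ∑ a, Complex.normSq (φ a) = 1) :
    estimatorVariance μ m (ketbra ψ) (ketbra φ) =
      ∫ U : UGroup n, sampleMean (m := m) (fun o => roundEstimator o ^ 2)
        ((U : Op n) *ᵥ ψ) ((U : Op n) *ᵥ φ) ∂μ - overlap ψ φ ^ 2 := by
  have := isProbabilityMeasure_roundLaw μ m hψ hφ
  rw [estimatorVariance, variance_eq_sub MemLp.of_discrete, hμ.integral_roundEstimator hm hψ hφ]
  simp only [Pi.pow_apply]
  rw [integral_roundLaw]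

lemma overlap_self {n : ℕ} {ψ : Bits n → ℂ} (hψ : ∑ a, Complex.normSq (ψ a) = 1) :
    overlap ψ ψ = 1 := by
  have h : ψ ⬝ᵥ star ψ = ((∑ a, Complex.normSq (ψ a) : ℝ) : ℂ) := by
    simp [dotProduct, Complex.mul_conj]
  rw [overlap, h, hψ]
  simp

/-! ### Averages over random states -/

section Averages

variable {ι : Type*} [Fintype ι] [DecidableEq ι] {ν : Measure (ι → ℂ)}

lemma IsInvariantLaw.ae_prod_unit_norm (hν : IsInvariantLaw ν) : ∀ᵐ p ∂ν.prod ν,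
    ∑ a, Complex.normSq (p.1 a) = 1 ∧ ∑ a, Complex.normSq (p.2 a) = 1 := by
  have := hν.prob
  exact (Measure.quasiMeasurePreserving_fst.ae hν.unit_norm).and
    (Measure.quasiMeasurePreserving_snd.ae hν.unit_norm)

omit [DecidableEq ι] in
lemma exists_bound_of_unit_norm
    {f : (ι → ℂ) × (ι → ℂ) → ℝ} (hf : Continuous f) : ∃ C, ∀ p : (ι → ℂ) × (ι → ℂ),
      ∑ a, Complex.normSq (p.1 a) = 1 → ∑ a, Complex.normSq (p.2 a) = 1 → ‖f p‖ ≤ C := by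
  obtain ⟨C, hC⟩ := ((isCompact_unitVectors (ι := ι)).prod
    (isCompact_unitVectors (ι := ι))).exists_bound_of_continuousOn hf.continuousOn
  exact ⟨C, fun p h1 h2 => hC p ⟨h1, h2⟩⟩

lemma IsInvariantLaw.integrable_prod (hν : IsInvariantLaw ν)
    {f : (ι → ℂ) × (ι → ℂ) → ℝ} (hf : Continuous f) : Integrable f (ν.prod ν) := by
  have := hν.prob
  obtain ⟨C, hC⟩ := exists_bound_of_unit_norm hf
  refine Integrable.of_bound hf.aestronglyMeasurable C ?_
  filter_upwards [hν.ae_prod_unit_norm] with p hp using hC p hp.1 hp.2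

end Averages

/-- Averaging over a random rotation does nothing to an invariant law of states. -/
lemma integral_integral_mulVec {n : ℕ} {ν : Measure (Bits n → ℂ)} (hν : IsInvariantLaw ν)
    (μ : Measure (UGroup n)) [IsProbabilityMeasure μ] {f : (Bits n → ℂ) → ℝ} (hf : Continuous f) :
    ∫ ψ, ∫ U : UGroup n, f ((U : Op n) *ᵥ ψ) ∂μ ∂ν = ∫ ψ, f ψ ∂ν := by
  have := hν.prob
  obtain ⟨C, hC⟩ := isCompact_unitVectors.exists_bound_of_continuousOn hf.continuousOn
  rw [integral_integral_swap]
  · simp only [fun U : UGroup n => hν.integral_mulVec hf U.2, integral_const, probReal_univ,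
      one_smul]
  · refine Integrable.of_bound (Continuous.aestronglyMeasurable ?_) C ?_
    · simp only [Function.uncurry_def]
      fun_prop
    · filter_upwards [Measure.quasiMeasurePreserving_fst.ae hν.unit_norm] with p hp
      exact hC _ ((sum_normSq_mulVec p.2 p.1).trans hp)

/-- Averaging over a random common rotation does nothing to a pair of independent states with an
invariant law. -/
lemma integral_integral_mulVec_prod {n : ℕ} {ν : Measure (Bits n → ℂ)} (hν : IsInvariantLaw ν)
    (μ : Measure (UGroup n)) [IsProbabilityMeasure μ] {f : (Bits n → ℂ) × (Bits n → ℂ) → ℝ}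
    (hf : Continuous f) :
    ∫ p, ∫ U : UGroup n, f ((U : Op n) *ᵥ p.1, (U : Op n) *ᵥ p.2) ∂μ ∂ν.prod ν =
      ∫ p, f p ∂ν.prod ν := by
  have := hν.prob
  obtain ⟨C, hC⟩ := exists_bound_of_unit_norm hf
  have hinv (U : UGroup n) : ∫ p, f ((U : Op n) *ᵥ p.1, (U : Op n) *ᵥ p.2) ∂ν.prod ν =
      ∫ p, f p ∂ν.prod ν := by
    have h := Measure.map_prod_map (f := fun v => (U : Op n) *ᵥ v)
      (g := fun v => (U : Op n) *ᵥ v) ν ν (by fun_prop) (by fun_prop)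
    rw [hν.invariant _ U.2] at h
    conv_rhs => rw [h]
    rw [integral_map (by fun_prop) hf.aestronglyMeasurable]
    rfl
  rw [integral_integral_swap]
  · simp only [hinv, integral_const, probReal_univ, one_smul]
  · refine Integrable.of_bound (Continuous.aestronglyMeasurable ?_) C ?_
    · simp only [Function.uncurry_def]
      fun_prop
    · filter_upwards [Measure.quasiMeasurePreserving_fst.ae hν.ae_prod_unit_norm] with p hp
      exact hC _ ((sum_normSq_mulVec p.2 p.1.1).trans hp.1)
        ((sum_normSq_mulVec p.2 p.1.2).trans hp.2)

section CollisionMoments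

variable {ι : Type*} [Fintype ι] [DecidableEq ι] [Nonempty ι] {ν : Measure (ι → ℂ)}

namespace IsInvariantLaw

lemma integral_sum_sq (hν : IsInvariantLaw ν) :
    ∫ v, ∑ a, Complex.normSq (v a) * Complex.normSq (v a) ∂ν = 2 / (Fintype.card ι + 1) := by
  have hd : (0 : ℝ) < Fintype.card ι := Nat.cast_pos.mpr Fintype.card_pos
  rw [integral_finsetSum _ fun a _ => hν.integrable (by fun_prop)]
  simp only [← pow_two, hν.moment_two, Finset.sum_const, Finset.card_univ, nsmul_eq_mul]
  field_simp

lemma integral_sum_cube (hν : IsInvariantLaw ν) :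
    ∫ v, ∑ a, Complex.normSq (v a) * Complex.normSq (v a) ^ 2 ∂ν =
      6 / ((Fintype.card ι + 1) * (Fintype.card ι + 2)) := by
  have hd : (0 : ℝ) < Fintype.card ι := Nat.cast_pos.mpr Fintype.card_pos
  rw [integral_finsetSum _ fun a _ => hν.integrable (by fun_prop)]
  simp only [← pow_succ', Nat.reduceAdd, hν.moment_three, Finset.sum_const, Finset.card_univ,
    nsmul_eq_mul]
  field_simp

lemma integral_sum_sq_sq (hν : IsInvariantLaw ν) :
    ∫ v, (∑ a, Complex.normSq (v a) * Complex.normSq (v a)) ^ 2 ∂ν =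
      (4 * Fintype.card ι + 20) /
        ((Fintype.card ι + 1) * (Fintype.card ι + 2) * (Fintype.card ι + 3)) := by
  have hd : (0 : ℝ) < Fintype.card ι := Nat.cast_pos.mpr Fintype.card_pos
  have hexp (v : ι → ℂ) : (∑ a, Complex.normSq (v a) * Complex.normSq (v a)) ^ 2 =
      ∑ a, ∑ b, Complex.normSq (v a) ^ 2 * Complex.normSq (v b) ^ 2 := by
    simp only [← pow_two]
    rw [pow_two, Finset.sum_mul_sum]
  have hrow (a : ι) : ∫ v, ∑ b, Complex.normSq (v a) ^ 2 * Complex.normSq (v b) ^ 2 ∂ν =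
      24 / (Fintype.card ι * (Fintype.card ι + 1) * (Fintype.card ι + 2) * (Fintype.card ι + 3))
      + (Fintype.card ι - 1) * (4 / (Fintype.card ι * (Fintype.card ι + 1) *
        (Fintype.card ι + 2) * (Fintype.card ι + 3))) := by
    rw [integral_finsetSum _ fun b _ => hν.integrable (by fun_prop),
      ← Finset.add_sum_erase _ _ (Finset.mem_univ a),
      Finset.sum_congr rfl fun b hb => hν.moment_two_two (Finset.ne_of_mem_erase hb).symm]
    simp only [← pow_add, Nat.reduceAdd, hν.moment_four, Finset.sum_const, Finset.mem_univ,
      Finset.card_erase_of_mem, Finset.card_univ, nsmul_eq_mul,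
      Nat.cast_sub (Fintype.card_pos_iff.mpr ⟨a⟩), Nat.cast_one]
  simp only [hexp]
  rw [integral_finsetSum _ fun a _ => hν.integrable (by fun_prop)]
  simp only [hrow, Finset.sum_const, Finset.card_univ, nsmul_eq_mul]
  field_simp
  ring

lemma integral_prod_sum_mul (hν : IsInvariantLaw ν) :
    ∫ p, ∑ a, Complex.normSq (p.1 a) * Complex.normSq (p.2 a) ∂ν.prod ν = 1 / Fintype.card ι := by
  have := hν.prob
  have hd : (0 : ℝ) < Fintype.card ι := Nat.cast_pos.mpr Fintype.card_pos
  rw [integral_finsetSum _ fun a _ => hν.integrable_prod (by fun_prop)]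
  simp only [fun a => integral_prod_mul (μ := ν) (ν := ν) (fun v : ι → ℂ => Complex.normSq (v a))
    (fun v => Complex.normSq (v a)), hν.moment_one, Finset.sum_const, Finset.card_univ,
    nsmul_eq_mul]
  field_simp

lemma integral_prod_sum_mul_sq (hν : IsInvariantLaw ν) :
    ∫ p, ∑ a, Complex.normSq (p.1 a) * Complex.normSq (p.2 a) ^ 2 ∂ν.prod ν =
      2 / (Fintype.card ι * (Fintype.card ι + 1)) := by
  have := hν.prob
  have hd : (0 : ℝ) < Fintype.card ι := Nat.cast_pos.mpr Fintype.card_pos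
  rw [integral_finsetSum _ fun a _ => hν.integrable_prod (by fun_prop)]
  simp only [fun a => integral_prod_mul (μ := ν) (ν := ν) (fun v : ι → ℂ => Complex.normSq (v a))
    (fun v => Complex.normSq (v a) ^ 2), hν.moment_one, hν.moment_two, Finset.sum_const,
    Finset.card_univ, nsmul_eq_mul]
  field_simp

lemma integral_prod_sum_sq_mul (hν : IsInvariantLaw ν) :
    ∫ p, ∑ a, Complex.normSq (p.2 a) * Complex.normSq (p.1 a) ^ 2 ∂ν.prod ν =
      2 / (Fintype.card ι * (Fintype.card ι + 1)) := by
  have := hν.prob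
  rw [← hν.integral_prod_sum_mul_sq]
  exact integral_prod_swap (μ := ν) (ν := ν)
    (fun p : (ι → ℂ) × (ι → ℂ) => ∑ a, Complex.normSq (p.1 a) * Complex.normSq (p.2 a) ^ 2)

lemma integral_prod_sum_mul_all_sq (hν : IsInvariantLaw ν) :
    ∫ p, (∑ a, Complex.normSq (p.1 a) * Complex.normSq (p.2 a)) ^ 2 ∂ν.prod ν =
      (Fintype.card ι + 3) / (Fintype.card ι * (Fintype.card ι + 1) ^ 2) := by
  have := hν.prob
  have hd : (0 : ℝ) < Fintype.card ι := Nat.cast_pos.mpr Fintype.card_pos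
  have hexp (p : (ι → ℂ) × (ι → ℂ)) :
      (∑ a, Complex.normSq (p.1 a) * Complex.normSq (p.2 a)) ^ 2 =
      ∑ a, ∑ b, (Complex.normSq (p.1 a) * Complex.normSq (p.1 b)) *
        (Complex.normSq (p.2 a) * Complex.normSq (p.2 b)) := by
    rw [pow_two, Finset.sum_mul_sum]
    exact Finset.sum_congr rfl fun a _ => Finset.sum_congr rfl fun b _ => by ring
  have hentry (a b : ι) : ∫ p, (Complex.normSq (p.1 a) * Complex.normSq (p.1 b)) *
        (Complex.normSq (p.2 a) * Complex.normSq (p.2 b)) ∂ν.prod ν =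
      (∫ v, Complex.normSq (v a) * Complex.normSq (v b) ∂ν) ^ 2 := by
    rw [pow_two]
    exact integral_prod_mul (μ := ν) (ν := ν)
      (fun v : ι → ℂ => Complex.normSq (v a) * Complex.normSq (v b))
      (fun v => Complex.normSq (v a) * Complex.normSq (v b))
  have hrow (a : ι) : ∫ p, ∑ b, (Complex.normSq (p.1 a) * Complex.normSq (p.1 b)) *
        (Complex.normSq (p.2 a) * Complex.normSq (p.2 b)) ∂ν.prod ν =
      (2 / (Fintype.card ι * (Fintype.card ι + 1))) ^ 2
      + (Fintype.card ι - 1) * (1 / (Fintype.card ι * (Fintype.card ι + 1))) ^ 2 := by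
    rw [integral_finsetSum _ fun b _ => hν.integrable_prod (by fun_prop)]
    simp only [hentry]
    rw [← Finset.add_sum_erase _ _ (Finset.mem_univ a), Finset.sum_congr rfl fun b hb =>
      congrArg (fun t : ℝ => t ^ 2) (hν.moment_one_one (Finset.ne_of_mem_erase hb).symm)]
    simp only [← pow_two, hν.moment_two, Finset.sum_const, Finset.mem_univ,
      Finset.card_erase_of_mem, Finset.card_univ, nsmul_eq_mul,
      Nat.cast_sub (Fintype.card_pos_iff.mpr ⟨a⟩), Nat.cast_one]
  simp only [hexp]
  rw [integral_finsetSum _ fun a _ => hν.integrable_prod (by fun_prop)]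
  simp only [hrow, Finset.sum_const, Finset.card_univ, nsmul_eq_mul]
  field_simp
  ring

end IsInvariantLaw

end CollisionMoments

lemma card_bits (n : ℕ) : (Fintype.card (Bits n) : ℝ) = 2 ^ n := by simp [Bits, ZMod.card]

/-! ### The average variances -/

lemma integral_secondMoment_bound {Ω : Type*} [MeasurableSpace Ω] {P : Measure Ω}
    [IsProbabilityMeasure P] {S K L : Ω → ℝ} (hS : Integrable S P)
    (hS2 : Integrable (fun x => S x ^ 2) P) (hK : Integrable K P) (hL : Integrable L P) (d m : ℝ) :
    Integrable (fun x => (1 + d ^ 2 * S x) / m ^ 2 + (2 + (d + 1) ^ 2 * (K x + L x)) / m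
        + ((d + 1) * S x - 1) ^ 2) P ∧
    ∫ x, ((1 + d ^ 2 * S x) / m ^ 2 + (2 + (d + 1) ^ 2 * (K x + L x)) / m
        + ((d + 1) * S x - 1) ^ 2) ∂P =
      (1 + d ^ 2 * ∫ x, S x ∂P) / m ^ 2 + (2 + (d + 1) ^ 2 * (∫ x, K x ∂P + ∫ x, L x ∂P)) / m
        + ((d + 1) ^ 2 * ∫ x, S x ^ 2 ∂P - 2 * (d + 1) * ∫ x, S x ∂P + 1) := by
  have hsq : (fun x => ((d + 1) * S x - 1) ^ 2) =
      fun x => (d + 1) ^ 2 * S x ^ 2 - 2 * (d + 1) * S x + 1 := by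
    funext x; ring
  have i1 : Integrable (fun x => (1 + d ^ 2 * S x) / m ^ 2) P :=
    ((integrable_const 1).add (hS.const_mul _)).div_const _
  have i2 : Integrable (fun x => (2 + (d + 1) ^ 2 * (K x + L x)) / m) P :=
    ((integrable_const 2).add ((hK.add hL).const_mul _)).div_const _
  have i3 : Integrable (fun x => (d + 1) ^ 2 * S x ^ 2 - 2 * (d + 1) * S x) P :=
    (hS2.const_mul _).sub (hS.const_mul _)
  have i4 : Integrable (fun x => ((d + 1) * S x - 1) ^ 2) P := by
    rw [hsq]
    exact i3.add (integrable_const 1)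
  have i5 : Integrable (fun x =>
      (1 + d ^ 2 * S x) / m ^ 2 + (2 + (d + 1) ^ 2 * (K x + L x)) / m) P :=
    i1.add i2
  have i6 : Integrable (fun x => (d + 1) ^ 2 * (K x + L x)) P := (hK.add hL).const_mul _
  refine ⟨i5.add i4, ?_⟩
  rw [integral_add i5 i4, integral_add i1 i2, hsq, integral_add i3 (integrable_const 1),
    integral_sub (hS2.const_mul _) (hS.const_mul _), integral_div, integral_div,
    integral_add (integrable_const 1) (hS.const_mul _), integral_add (integrable_const 2) i6]
  simp only [integral_const_mul, integral_add hK hL, integral_const, probReal_univ, smul_eq_mul,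
    one_mul]

lemma equal_states_bound {d m : ℝ} (hd : 1 ≤ d) (hm : 0 < m) :
    (1 + d ^ 2 * (2 / (d + 1))) / m ^ 2
      + (2 + (d + 1) ^ 2 * (6 / ((d + 1) * (d + 2)) + 6 / ((d + 1) * (d + 2)))) / m
      + ((d + 1) ^ 2 * ((4 * d + 20) / ((d + 1) * (d + 2) * (d + 3)))
        - 2 * (d + 1) * (2 / (d + 1)) + 1) - 1 ≤ 14 * (d / m ^ 2 + 1 / m + 1 / d) := by
  have hd0 : 0 < d := by linarith
  have e1 : 1 + d ^ 2 * (2 / (d + 1)) ≤ 14 * d := by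
    have : d ^ 2 * (2 / (d + 1)) ≤ 2 * d := by
      rw [← mul_div_assoc, div_le_iff₀ (by positivity)]
      nlinarith
    linarith
  have e2 : 2 + (d + 1) ^ 2 * (6 / ((d + 1) * (d + 2)) + 6 / ((d + 1) * (d + 2))) ≤ 14 := by
    have h : (d + 1) ^ 2 * (6 / ((d + 1) * (d + 2)) + 6 / ((d + 1) * (d + 2))) =
        12 * (d + 1) / (d + 2) := by field_simp; norm_num
    have : 12 * (d + 1) / (d + 2) ≤ 12 := by
      rw [div_le_iff₀ (by positivity)]
      linarith
    linarith
  have e3 : (d + 1) ^ 2 * ((4 * d + 20) / ((d + 1) * (d + 2) * (d + 3)))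
      - 2 * (d + 1) * (2 / (d + 1)) + 1 - 1 ≤ 14 / d := by
    have : (d + 1) ^ 2 * ((4 * d + 20) / ((d + 1) * (d + 2) * (d + 3)))
      - 2 * (d + 1) * (2 / (d + 1)) + 1 - 1 = 4 * (d - 1) / ((d + 2) * (d + 3)) := by
      field_simp
      ring
    rw [this, div_le_div_iff₀ (by positivity) (by positivity)]
    nlinarith
  have f1 := div_le_div_of_nonneg_right e1 (sq_nonneg m)
  have f2 := div_le_div_of_nonneg_right e2 hm.le
  have f3 : 14 * (d / m ^ 2 + 1 / m + 1 / d) = 14 * d / m ^ 2 + 14 / m + 14 / d := by ring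
  rw [f3]
  linarith

lemma independent_states_bound {d m : ℝ} (hd : 1 ≤ d) (hm : 0 < m) :
    (1 + d ^ 2 * (1 / d)) / m ^ 2
      + (2 + (d + 1) ^ 2 * (2 / (d * (d + 1)) + 2 / (d * (d + 1)))) / m
      + ((d + 1) ^ 2 * ((d + 3) / (d * (d + 1) ^ 2)) - 2 * (d + 1) * (1 / d) + 1) ≤
        14 * (d / m ^ 2 + 1 / m + 1 / d) := by
  have hd0 : 0 < d := by linarith
  have e1 : 1 + d ^ 2 * (1 / d) ≤ 14 * d := by
    have : d ^ 2 * (1 / d) = d := by field_simp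
    linarith
  have e2 : 2 + (d + 1) ^ 2 * (2 / (d * (d + 1)) + 2 / (d * (d + 1))) ≤ 14 := by
    have h : (d + 1) ^ 2 * (2 / (d * (d + 1)) + 2 / (d * (d + 1))) = 4 * (d + 1) / d := by
      field_simp; norm_num
    have : 4 * (d + 1) / d ≤ 12 := by
      rw [div_le_iff₀ (by positivity)]
      linarith
    linarith
  have e3 : (d + 1) ^ 2 * ((d + 3) / (d * (d + 1) ^ 2)) - 2 * (d + 1) * (1 / d) + 1 ≤ 14 / d := by
    have : (d + 1) ^ 2 * ((d + 3) / (d * (d + 1) ^ 2)) - 2 * (d + 1) * (1 / d) + 1 = 1 / d := by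
      field_simp
      ring
    rw [this]
    exact div_le_div_of_nonneg_right (by norm_num) hd0.le
  have f1 := div_le_div_of_nonneg_right e1 (sq_nonneg m)
  have f2 := div_le_div_of_nonneg_right e2 hm.le
  have f3 : 14 * (d / m ^ 2 + 1 / m + 1 / d) = 14 * d / m ^ 2 + 14 / m + 14 / d := by ring
  rw [f3]
  linarith

lemma integrable_estimatorVariance {n : ℕ} (μ : Measure (UGroup n)) [IsFiniteMeasure μ] (m : ℕ) :
    Integrable (fun p : (Bits n → ℂ) × (Bits n → ℂ) =>
      estimatorVariance μ m (ketbra p.1) (ketbra p.2)) ((haarState n).prod (haarState n)) :=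
  (haarState_isInvariantLaw n).integrable_prod (continuous_estimatorVariance μ m)

lemma integrable_estimatorVariance_diag {n : ℕ} (μ : Measure (UGroup n)) [IsFiniteMeasure μ]
    (m : ℕ) : Integrable (fun ψ : Bits n → ℂ => estimatorVariance μ m (ketbra ψ) (ketbra ψ))
      (haarState n) := by
  have h : Continuous fun ψ : Bits n → ℂ => (ψ, ψ) := by fun_prop
  have hc := (continuous_estimatorVariance μ m).comp h
  simp only [Function.comp_def] at hc
  exact (haarState_isInvariantLaw n).integrable hc

lemma continuous_integral_sampleMean {n m : ℕ} (μ : Measure (UGroup n)) [IsFiniteMeasure μ]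
    (g : Outcome n m → ℝ) : Continuous fun p : (Bits n → ℂ) × (Bits n → ℂ) =>
      ∫ U : UGroup n, sampleMean g ((U : Op n) *ᵥ p.1) ((U : Op n) *ᵥ p.2) ∂μ := by
  simp only [← integral_roundLaw, integral_roundLaw_eq_sum]
  have h := fun o : Outcome n m => continuous_roundProb μ o
  fun_prop

lemma IsUnitaryDesign.averageVarianceOne_eq {n m : ℕ} (hm : 1 ≤ m) {μ : Measure (UGroup n)}
    [IsProbabilityMeasure μ] (hμ : IsUnitaryDesign μ 2) : averageVarianceOne μ m =
      ∫ ψ, sampleMean (m := m) (fun o => roundEstimator o ^ 2) ψ ψ ∂haarState n - 1 := by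
  have hν := haarState_isInvariantLaw n
  have := hν.prob
  have hdiag : Continuous fun ψ : Bits n → ℂ => (ψ, ψ) := by fun_prop
  have h : ∫ ψ : Bits n → ℂ, (∫ U : UGroup n, sampleMean (m := m)
        (fun o => roundEstimator o ^ 2) ((U : Op n) *ᵥ ψ) ((U : Op n) *ᵥ ψ) ∂μ - 1) ∂haarState n =
      averageVarianceOne μ m := by
    refine integral_congr_ae ?_
    filter_upwards [hν.unit_norm] with ψ hψ
    rw [hμ.estimatorVariance_eq hm hψ hψ, overlap_self hψ, one_pow]
  have hc := (continuous_sampleMean fun o : Outcome n m => roundEstimator o ^ 2).comp hdiag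
  have hcU :=
    (continuous_integral_sampleMean μ fun o : Outcome n m => roundEstimator o ^ 2).comp hdiag
  simp only [Function.comp_def] at hc hcU
  rw [← h, integral_sub (hν.integrable hcU) (integrable_const _),
    integral_integral_mulVec hν μ hc]
  simp

lemma IsUnitaryDesign.averageVarianceTwo_le_integral {n m : ℕ} (hm : 1 ≤ m)
    {μ : Measure (UGroup n)} [IsProbabilityMeasure μ] (hμ : IsUnitaryDesign μ 2) :
    averageVarianceTwo μ m ≤ ∫ p : (Bits n → ℂ) × (Bits n → ℂ),
      sampleMean (m := m) (fun o => roundEstimator o ^ 2) p.1 p.2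
        ∂(haarState n).prod (haarState n) := by
  have hν := haarState_isInvariantLaw n
  rw [← integral_integral_mulVec_prod hν μ (continuous_sampleMean _)]
  refine integral_mono_ae (integrable_estimatorVariance μ m)
    (hν.integrable_prod (continuous_integral_sampleMean μ _)) ?_
  filter_upwards [hν.ae_prod_unit_norm] with p hp
  rw [hμ.estimatorVariance_eq hm hp.1 hp.2]
  exact sub_le_self _ (sq_nonneg _)

lemma IsUnitaryDesign.averageVarianceOne_le {n m : ℕ} (hm : 1 ≤ m) {μ : Measure (UGroup n)}
    [IsProbabilityMeasure μ] (hμ : IsUnitaryDesign μ 2) :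
    averageVarianceOne μ m ≤ 14 * (2 ^ n / (m : ℝ) ^ 2 + 1 / (m : ℝ) + 1 / 2 ^ n) := by
  have hν := haarState_isInvariantLaw n
  have := hν.prob
  have hdiag : Continuous fun ψ : Bits n → ℂ => (ψ, ψ) := by fun_prop
  have hS : Continuous fun ψ : Bits n → ℂ =>
    ∑ a, Complex.normSq (ψ a) * Complex.normSq (ψ a) := by fun_prop
  have hK : Continuous fun ψ : Bits n → ℂ =>
    ∑ a, Complex.normSq (ψ a) * Complex.normSq (ψ a) ^ 2 := by fun_prop
  obtain ⟨hint, hval⟩ := integral_secondMoment_bound (hν.integrable hS)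
    (hν.integrable (hS.pow 2)) (hν.integrable hK) (hν.integrable hK) (2 ^ n) m
  rw [hν.integral_sum_sq, hν.integral_sum_cube, hν.integral_sum_sq_sq, card_bits] at hval
  have hle := integral_mono_ae (hν.integrable ((continuous_sampleMean
    fun o : Outcome n m => roundEstimator o ^ 2).comp hdiag)) hint (by
      filter_upwards [hν.unit_norm] with ψ hψ using sampleMean_roundEstimator_sq_le hm hψ hψ)
  rw [hval] at hle
  rw [hμ.averageVarianceOne_eq hm]
  exact (sub_le_sub_right hle 1).trans
    (equal_states_bound (one_le_pow₀ (by norm_num)) (by exact_mod_cast hm))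

lemma IsUnitaryDesign.averageVarianceTwo_le {n m : ℕ} (hm : 1 ≤ m) {μ : Measure (UGroup n)}
    [IsProbabilityMeasure μ] (hμ : IsUnitaryDesign μ 2) :
    averageVarianceTwo μ m ≤ 14 * (2 ^ n / (m : ℝ) ^ 2 + 1 / (m : ℝ) + 1 / 2 ^ n) := by
  have hν := haarState_isInvariantLaw n
  have := hν.prob
  have hS : Continuous fun p : (Bits n → ℂ) × (Bits n → ℂ) =>
    ∑ a, Complex.normSq (p.1 a) * Complex.normSq (p.2 a) := by fun_prop
  have hK : Continuous fun p : (Bits n → ℂ) × (Bits n → ℂ) =>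
    ∑ a, Complex.normSq (p.2 a) * Complex.normSq (p.1 a) ^ 2 := by fun_prop
  have hL : Continuous fun p : (Bits n → ℂ) × (Bits n → ℂ) =>
    ∑ a, Complex.normSq (p.1 a) * Complex.normSq (p.2 a) ^ 2 := by fun_prop
  obtain ⟨hint, hval⟩ := integral_secondMoment_bound (hν.integrable_prod hS)
    (hν.integrable_prod (hS.pow 2)) (hν.integrable_prod hK) (hν.integrable_prod hL) (2 ^ n) m
  rw [hν.integral_prod_sum_mul, hν.integral_prod_sum_mul_sq, hν.integral_prod_sum_sq_mul,
    hν.integral_prod_sum_mul_all_sq, card_bits] at hval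
  have hle := integral_mono_ae (hν.integrable_prod (continuous_sampleMean
    fun o : Outcome n m => roundEstimator o ^ 2)) hint (by
      filter_upwards [hν.ae_prod_unit_norm] with p hp
        using sampleMean_roundEstimator_sq_le hm hp.1 hp.2)
  rw [hval] at hle
  exact (hμ.averageVarianceTwo_le_integral hm).trans (hle.trans
    (independent_states_bound (one_le_pow₀ (by norm_num)) (by exact_mod_cast hm)))

/-! ### Failure probability and sample complexity -/

/-- Chebyshev's inequality for the mean of independent rounds. -/
lemma IsUnitaryDesign.failureProb_le {n m N : ℕ} {μ : Measure (UGroup n)}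
    [IsProbabilityMeasure μ] (hμ : IsUnitaryDesign μ 2) (hm : 1 ≤ m) (hN : 1 ≤ N) {ε : ℝ}
    (hε : 0 < ε) {ψ φ : Bits n → ℂ} (hψ : ∑ a, Complex.normSq (ψ a) = 1)
    (hφ : ∑ a, Complex.normSq (φ a) = 1) :
    failureProb μ N m ε (ketbra ψ) (ketbra φ) ≤
      ENNReal.ofReal (estimatorVariance μ m (ketbra ψ) (ketbra φ) / (N * ε ^ 2)) := by
  have := isProbabilityMeasure_roundLaw μ m hψ hφ
  have hN0 : (N : ℝ) ≠ 0 := by positivity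
  have : MeasurableSingletonClass (Fin N → Outcome n m) := Pi.instMeasurableSingletonClass
  set P := Measure.pi fun _ : Fin N => roundLaw μ (ketbra ψ) (ketbra φ) m with hP
  have hmean : ∫ ω, meanEstimator ω ∂P = overlap ψ φ := by
    simp only [meanEstimator]
    rw [integral_const_mul, integral_finsetSum _ fun t _ => Integrable.of_finite]
    simp only [hP, fun t : Fin N => integral_comp_eval
      (μ := fun _ : Fin N => roundLaw μ (ketbra ψ) (ketbra φ) m) (i := t)
      (f := fun o : Outcome n m => roundEstimator o) Measurable.of_discrete.aestronglyMeasurable,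
      hμ.integral_roundEstimator hm hψ hφ, Finset.sum_const, Finset.card_univ, Fintype.card_fin,
      nsmul_eq_mul]
    field_simp
  have hvar : Var[meanEstimator; P] = estimatorVariance μ m (ketbra ψ) (ketbra φ) / N := by
    have h := variance_sum_pi (μ := fun _ : Fin N => roundLaw μ (ketbra ψ) (ketbra φ) m)
      (X := fun _ o => roundEstimator o) fun _ => MemLp.of_discrete
    have h2 : (meanEstimator : (Fin N → Outcome n m) → ℝ) =
        fun ω => 1 / (N : ℝ) * (∑ t, fun ω : Fin N → Outcome n m => roundEstimator (ω t)) ω := by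
      funext ω
      simp [meanEstimator]
    rw [h2, variance_const_mul, h]
    simp only [Finset.sum_const, Finset.card_univ, Fintype.card_fin, nsmul_eq_mul,
      estimatorVariance]
    field_simp
  have h := meas_ge_le_variance_div_sq (μ := P) (X := meanEstimator) MemLp.of_discrete hε
  rw [hmean, hvar, div_div] at h
  rw [failureProb, trace_ketbra_mul]
  exact h

lemma IsUnitaryDesign.averageFailureOne_le {n m N : ℕ} {μ : Measure (UGroup n)}
    [IsProbabilityMeasure μ] (hμ : IsUnitaryDesign μ 2) (hm : 1 ≤ m) (hN : 1 ≤ N) {ε : ℝ}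
    (hε : 0 < ε) :
    averageFailureOne μ N m ε ≤ ENNReal.ofReal (averageVarianceOne μ m / (N * ε ^ 2)) := by
  rw [averageVarianceOne, ← integral_div, ofReal_integral_eq_lintegral_ofReal
    ((integrable_estimatorVariance_diag μ m).div_const _)
    (Filter.Eventually.of_forall fun ψ => div_nonneg (variance_nonneg _ _) (by positivity))]
  refine lintegral_mono_ae ?_
  filter_upwards [(haarState_isInvariantLaw n).unit_norm] with ψ hψ
    using hμ.failureProb_le hm hN hε hψ hψ

lemma IsUnitaryDesign.averageFailureTwo_le {n m N : ℕ} {μ : Measure (UGroup n)}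
    [IsProbabilityMeasure μ] (hμ : IsUnitaryDesign μ 2) (hm : 1 ≤ m) (hN : 1 ≤ N) {ε : ℝ}
    (hε : 0 < ε) :
    averageFailureTwo μ N m ε ≤ ENNReal.ofReal (averageVarianceTwo μ m / (N * ε ^ 2)) := by
  rw [averageVarianceTwo, ← integral_div, ofReal_integral_eq_lintegral_ofReal
    ((integrable_estimatorVariance μ m).div_const _)
    (Filter.Eventually.of_forall fun p => div_nonneg (variance_nonneg _ _) (by positivity))]
  refine lintegral_mono_ae ?_
  filter_upwards [(haarState_isInvariantLaw n).ae_prod_unit_norm] with p hp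
    using hμ.failureProb_le hm hN hε hp.1 hp.2

/-- The choice of the numbers of rounds and of shots. If `x ≥ 1 / 2 ^ n`, boundedly many rounds with
about `√(2 ^ n / x)` shots suffice; otherwise rounds with `2 ^ n` shots, beyond which more shots no
longer decrease the variance, are repeated about `1 / (2 ^ n x)` times. -/
lemma exists_rounds_and_shots (n : ℕ) {x : ℝ} (hx0 : 0 < x) (hx1 : x ≤ 1) :
    ∃ N m : ℕ, 1 ≤ N ∧ 1 ≤ m ∧
      (N : ℝ) * m ≤ 84 * max (1 / x) (√(2 ^ n / x)) ∧
      14 * (2 ^ n / (m : ℝ) ^ 2 + 1 / m + 1 / 2 ^ n) / x ≤ N := by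
  set d : ℝ := 2 ^ n with hd
  have hd1 : 1 ≤ d := one_le_pow₀ (by norm_num)
  have hd0 : 0 < d := by linarith
  -- the terms `d / m ^ 2`, `1 / m`, `1 / d` are at most `x` in the first case, where `42 = 3 * 14`
  -- rounds suffice, and equal to `1 / d` in the second, which takes `42 / (d * x)` rounds
  rcases le_or_gt 1 (d * x) with hdx | hdx
  · have hs1 : 1 ≤ √(d / x) := Real.one_le_sqrt.mpr ((one_le_div hx0).mpr (hx1.trans hd1))
    have hs2 : √(d / x) ^ 2 = d / x := Real.sq_sqrt (by positivity)
    have hsx : 1 / x ≤ √(d / x) := by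
      refine Real.le_sqrt_of_sq_le ?_
      rw [div_pow, one_pow, div_le_div_iff₀ (by positivity) hx0]
      nlinarith
    have hlt := Nat.ceil_lt_add_one (zero_le_one.trans hs1)
    have hle := Nat.le_ceil (√(d / x))
    set s := √(d / x)
    have hs0 : 0 < s := by linarith
    refine ⟨42, ⌈s⌉₊, by norm_num, Nat.one_le_ceil_iff.mpr hs0, ?_, ?_⟩
    · have := le_max_right (1 / x) s
      push_cast
      linarith
    · have f1 : d / (⌈s⌉₊ : ℝ) ^ 2 ≤ x := by
        rw [div_le_iff₀ (by positivity)]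
        have h : s ^ 2 ≤ (⌈s⌉₊ : ℝ) ^ 2 := pow_le_pow_left₀ hs0.le hle 2
        rw [hs2, div_le_iff₀ hx0] at h
        linarith
      have f2 : 1 / (⌈s⌉₊ : ℝ) ≤ x := by
        rw [div_le_comm₀ (by positivity) hx0]
        exact hsx.trans hle
      have f3 : 1 / d ≤ x := by
        rw [div_le_iff₀ hd0]
        linarith
      rw [div_le_iff₀ hx0]
      push_cast
      linarith
  · have hdx0 : 0 < d * x := by positivity
    have hlt := Nat.ceil_lt_add_one (a := 42 / (d * x)) (by positivity)
    have hle := Nat.le_ceil (42 / (d * x))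
    have hone : 1 ≤ 1 / (d * x) := (one_le_div hdx0).mpr hdx.le
    refine ⟨⌈42 / (d * x)⌉₊, 2 ^ n, Nat.one_le_ceil_iff.mpr (by positivity), Nat.one_le_two_pow,
      ?_, ?_⟩
    · have h := le_max_left (1 / x) (√(d / x))
      have h2 : (⌈42 / (d * x)⌉₊ : ℝ) ≤ 43 * (1 / (d * x)) := by
        have : 42 / (d * x) = 42 * (1 / (d * x)) := by ring
        linarith
      have h3 : (⌈42 / (d * x)⌉₊ : ℝ) * d ≤ 43 * (1 / (d * x)) * d :=
        mul_le_mul_of_nonneg_right h2 hd0.le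
      have h4 : 43 * (1 / (d * x)) * d = 43 * (1 / x) := by field_simp
      have h5 : 0 ≤ 1 / x := by positivity
      push_cast
      linarith
    · refine le_of_eq_of_le ?_ hle
      push_cast
      rw [← hd]
      field_simp
      norm_num

lemma max_le_div_mul_sqrt {d x : ℝ} (hd : 1 ≤ d) (hx0 : 0 < x) (hx1 : x ≤ 1) :
    max (1 / x) (√(d / x)) ≤ 1 / x * √d := by
  have hs : 1 ≤ √d := Real.one_le_sqrt.mpr hd
  have hx : 1 ≤ 1 / x := by rw [le_div_iff₀ hx0]; linarith
  refine max_le (le_mul_of_one_le_right (by positivity) hs) ?_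
  refine Real.sqrt_le_iff.mpr ⟨by positivity, ?_⟩
  rw [mul_pow, Real.sq_sqrt (by linarith)]
  have h : d / x = 1 / x * d := by ring
  rw [h]
  exact mul_le_mul_of_nonneg_right (by nlinarith) (by linarith)

end DIPE

end

theorem mainTheorem3 :
    ∃ C : ℝ, 0 < C ∧
      (∀ (n m : ℕ), 1 ≤ m → ∀ μ : Measure (DIPE.UGroup n), IsProbabilityMeasure μ →
        DIPE.IsUnitaryDesign μ 2 →
          Integrable (fun ψ => DIPE.estimatorVariance μ m (DIPE.ketbra ψ) (DIPE.ketbra ψ))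
            (DIPE.haarState n) ∧
          Integrable (fun p : (DIPE.Bits n → ℂ) × (DIPE.Bits n → ℂ) =>
              DIPE.estimatorVariance μ m (DIPE.ketbra p.1) (DIPE.ketbra p.2))
            ((DIPE.haarState n).prod (DIPE.haarState n)) ∧
          DIPE.averageVarianceOne μ m ≤ C * (2 ^ n / (m : ℝ) ^ 2 + 1 / (m : ℝ) + 1 / 2 ^ n) ∧
          DIPE.averageVarianceTwo μ m ≤ C * (2 ^ n / (m : ℝ) ^ 2 + 1 / (m : ℝ) + 1 / 2 ^ n)) ∧
      (∀ (n : ℕ) (ε δ : ℝ), 0 < ε → ε < 1 → 0 < δ → δ < 1 →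
        ∃ N m : ℕ, 1 ≤ N ∧ 1 ≤ m ∧
          (N : ℝ) * (m : ℝ) ≤ C * max (1 / (δ * ε ^ 2)) (√(2 ^ n / (δ * ε ^ 2))) ∧
          (N : ℝ) * (m : ℝ) ≤ C * (1 / (δ * ε ^ 2)) * √(2 ^ n) ∧
          ∀ μ : Measure (DIPE.UGroup n), IsProbabilityMeasure μ → DIPE.IsUnitaryDesign μ 2 →
            DIPE.averageVarianceOne μ m / (δ * ε ^ 2) ≤ (N : ℝ) ∧
            DIPE.averageVarianceTwo μ m / (δ * ε ^ 2) ≤ (N : ℝ) ∧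
            DIPE.averageFailureOne μ N m ε ≤ ENNReal.ofReal δ ∧
            DIPE.averageFailureTwo μ N m ε ≤ ENNReal.ofReal δ) := by
  refine ⟨84, by norm_num, fun n m hm μ _ hμ => ?_, fun n ε δ hε0 hε1 hδ0 hδ1 => ?_⟩
  · have h : 14 * (2 ^ n / (m : ℝ) ^ 2 + 1 / (m : ℝ) + 1 / 2 ^ n) ≤
        84 * (2 ^ n / (m : ℝ) ^ 2 + 1 / (m : ℝ) + 1 / 2 ^ n) :=
      mul_le_mul_of_nonneg_right (by norm_num) (by positivity)
    exact ⟨DIPE.integrable_estimatorVariance_diag μ m, DIPE.integrable_estimatorVariance μ m,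
      (hμ.averageVarianceOne_le hm).trans h, (hμ.averageVarianceTwo_le hm).trans h⟩
  · have hx0 : 0 < δ * ε ^ 2 := by positivity
    have hx1 : δ * ε ^ 2 ≤ 1 :=
      mul_le_one₀ hδ1.le (by positivity) (pow_le_one₀ hε0.le hε1.le)
    obtain ⟨N, m, hN, hm, hNm, hvar⟩ := DIPE.exists_rounds_and_shots n hx0 hx1
    refine ⟨N, m, hN, hm, hNm, ?_, fun μ _ hμ => ?_⟩
    · rw [mul_assoc]
      exact hNm.trans (mul_le_mul_of_nonneg_left
        (DIPE.max_le_div_mul_sqrt (one_le_pow₀ (by norm_num)) hx0 hx1) (by norm_num))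
    · have h1 := (div_le_div_of_nonneg_right (hμ.averageVarianceOne_le hm) hx0.le).trans hvar
      have h2 := (div_le_div_of_nonneg_right (hμ.averageVarianceTwo_le hm) hx0.le).trans hvar
      -- the number of rounds makes the bound of Chebyshev's inequality at most `δ`
      have hδ {v : ℝ} (hv : v / (δ * ε ^ 2) ≤ N) : v / (N * ε ^ 2) ≤ δ := by
        have hN0 : (0 : ℝ) < N := by exact_mod_cast hN
        rw [div_le_iff₀ hx0] at hv
        rw [div_le_iff₀ (by positivity)]
        linarith
      exact ⟨h1, h2,
        (hμ.averageFailureOne_le hm hN hε0).trans (ENNReal.ofReal_le_ofReal (hδ h1)),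
        (hμ.averageFailureTwo_le hm hN hε0).trans (ENNReal.ofReal_le_ofReal (hδ h2))⟩
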